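/- \textbf{Graphs.} Graphs are finite and may have multiple edges, loops and semi-edges. A graph has a set $D$ of darts and a set $V$ of vertices; the darts are partitioned by the vertices (a vertex may have no darts, and is then isolated) and also into links, each consisting of one dart (a semi-edge) or two darts (a loop or a normal edge, according to whether the two darts belong to the same vertex or not). The size of a graph is its number of vertices plus its number of links. For connected $H$, a \emph{covering projection} $f:G\to H$ is a mapping of vertices and darts, surjective on darts, that maps the darts of each vertex $u$ of $G$ bijectively onto the darts of the vertex $f(u)$ and maps every link of $G$ onto a link of $H$; then $G$ \emph{covers} $H$. For arbitrary $H$, an \emph{equitable covering projection} $f:G\to H$ is a mapping whose restriction to each connected component of $G$ is a covering projection onto some connected component of $H$, and for which $|f^{-1}(u)|=|f^{-1}(v)|$ for all vertices $u,v$ of $H$; then $G$ \emph{equitably covers} $H$. For fixed $H$, the problem \textsc{$H$-Cover} ($H$ connected), respectively \textsc{$H$-EquitableCover}, asks whether an input graph $G$ covers, respectively equitably covers, $H$. For graphs $G,H$ with connected components $G_1,\dots,G_p$ and $H_1,\dots,H_q$, the \emph{covering pattern} $\mathrm{Cov}(G,H)$ is the bipartite graph on $\{g_1,\dots,g_p\}\cup\{h_1,\dots,h_q\}$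 in which $g_ih_j$ is an edge if and only if $G_i$ covers $H_j$, with weight $r_{ij}=|V(G_i)|/|V(H_j)|$. \textbf{Computation.} Running times are numbers of steps of unit-cost programs with finitely many variables holding binary trees, whose elementary steps are: assign the empty tree, pair two trees, take the first or second subtree, test for emptiness. (Polynomial time in this model is the usual polynomial time.) Numbers are given in unary, a graph on vertices $0,\dots,a-1$ by $a$ and the list that gives for each dart its vertex and the other dart of its link (or itself, for a semi-edge), and a covering pattern by the $p\times q$ matrix of its weights, with $0$ for non-edges. \textbf{Theorem.} Let $H$ be a fixed graph with connected components $H_1,\dots,H_q$, and suppose that \textsc{$H_i$-Cover} is polynomial-time solvable for every $i$. Then \textsc{$H$-EquitableCover} is polynomial-time solvable. More precisely, it is solved in polynomial time by running two programs one after the other: the first computes, from an input graph $G$, the covering pattern $\mathrm{Cov}(G,H)$ (for some numbering of the components of $G$) in time polynomial in the size $n$ of $G$; the second decides, from $\mathrm{Cov}(G,H)$ alone (for any numbering of the components of $G$), whether $G$ equitably covers $H$, in at most $C\,(n+1)^{q+1}$ steps, that is, in time $O(n^{q+1})$, where the constant $C$ does not depend on $G$. -/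

import Mathlib

/-! ### Graphs with multiple edges, loops and semi-edges (dart model) -/

/-- A graph with vertex set `V` and dart set `D`. Every dart belongs to one vertex, so the darts
are partitioned by the vertices (a vertex without darts is isolated). The partition of the darts
into links (sets of one or two darts) is given by an involution: the links are its orbits. -/
structure DartGraph (V D : Type*) where
  vert : D → V
  inv : D → D
  inv_inv : ∀ d, inv (inv d) = d

namespace DartGraph

variable {V D V' D' : Type*}

/-- The set of darts of a vertex. -/
def darts (G : DartGraph V D) (u : V) : Set D := {d | G.vert d = u}

/-- The links: normal edges and loops (two darts), semi-edges (one dart, fixed by `inv`). -/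
def links (G : DartGraph V D) : Set (Set D) := Set.range fun d => {d, G.inv d}

/-- The size of a graph: number of vertices plus number of links. -/
noncomputable def size (G : DartGraph V D) : ℕ := Nat.card V + G.links.ncard

/-- Two distinct vertices are adjacent if some link meets both of them. -/
def adjGraph (G : DartGraph V D) : SimpleGraph V where
  Adj u v := u ≠ v ∧ ∃ d, G.vert d = u ∧ G.vert (G.inv d) = v
  symm := ⟨fun _ _ h => ⟨h.1.symm, by
    obtain ⟨_, d, hu, hv⟩ := h
    exact ⟨G.inv d, hv, by rw [G.inv_inv]; exact hu⟩⟩⟩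
  loopless := ⟨fun _ h => h.1 rfl⟩

/-- The connected components of a graph. -/
abbrev Component (G : DartGraph V D) : Type _ := G.adjGraph.ConnectedComponent

/-- The darts of a component. -/
def compDarts (G : DartGraph V D) (c : G.Component) : Set D := {d | G.vert d ∈ c.supp}

theorem inv_mem_compDarts (G : DartGraph V D) (c : G.Component) {d : D}
    (h : d ∈ G.compDarts c) : G.inv d ∈ G.compDarts c := by
  by_cases hd : G.vert d = G.vert (G.inv d)
  · simpa [compDarts, ← hd] using h
  · have hadj : G.adjGraph.Adj (G.vert d) (G.vert (G.inv d)) := ⟨hd, d, rfl, rfl⟩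
    exact (c.mem_supp_congr_adj hadj).1 h

/-- A component, as a graph of its own (the subgraph induced by its vertices). -/
def component (G : DartGraph V D) (c : G.Component) :
    DartGraph ↥c.supp ↥(G.compDarts c) where
  vert d := ⟨G.vert d.1, d.2⟩
  inv d := ⟨G.inv d.1, G.inv_mem_compDarts c d.2⟩
  inv_inv d := Subtype.ext (G.inv_inv d.1)

/-- Covering projection onto a connected graph `H`: the dart map is surjective, maps the darts of
each vertex `u` bijectively onto the darts of the vertex `fV u`, and maps links onto links. -/
def IsCoveringProjection (G : DartGraph V D) (H : DartGraph V' D')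
    (fV : V → V') (fD : D → D') : Prop :=
  Function.Surjective fD ∧
  (∀ u, Set.BijOn fD (G.darts u) (H.darts (fV u))) ∧
  (∀ e ∈ G.links, fD '' e ∈ H.links)

/-- `G` covers the connected graph `H`. -/
def Covers (G : DartGraph V D) (H : DartGraph V' D') : Prop :=
  ∃ (fV : V → V') (fD : D → D'), G.IsCoveringProjection H fV fD

/-- Equitable covering projection between possibly disconnected graphs: its restriction to every
component of `G` is a covering projection onto some component of `H`, and all vertices of `H` have
equally many preimages. -/
def IsEquitableCoveringProjection (G : DartGraph V D) (H : DartGraph V' D')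
    (fV : V → V') (fD : D → D') : Prop :=
  (∀ c : G.Component, ∃ (c' : H.Component) (hV : Set.MapsTo fV c.supp c'.supp)
    (hD : Set.MapsTo fD (G.compDarts c) (H.compDarts c')),
    (G.component c).IsCoveringProjection (H.component c') hV.restrict hD.restrict) ∧
  (∀ u v : V', (fV ⁻¹' {u}).ncard = (fV ⁻¹' {v}).ncard)

/-- `G` equitably covers `H`. -/
def EquitablyCovers (G : DartGraph V D) (H : DartGraph V' D') : Prop :=
  ∃ (fV : V → V') (fD : D → D'), G.IsEquitableCoveringProjection H fV fD

open Classical in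
/-- The covering pattern of `G` and `H`, as a weighted bipartite graph between their components:
`c` and `c'` are joined if `c` covers `c'`, and the weight is then the (positive, integral) ratio
of their numbers of vertices. The value `0` means that there is no edge. -/
noncomputable def covPattern (G : DartGraph V D) (H : DartGraph V' D')
    (c : G.Component) (c' : H.Component) : ℕ :=
  if (G.component c).Covers (H.component c') then Nat.card c.supp / Nat.card c'.supp else 0

end DartGraph

/-! ### Machine model: unit-cost programs over binary trees

Programs have finitely many variables, each holding a (pointer to an immutable) binary tree. An
assignment performs one constructor or selector and a test inspects only whether a variable is
`nil`; each costs one step. Polynomial time in this model is the usual polynomial time. -/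

/-- Binary trees, the data of the programs. -/
inductive Val where
  | nil : Val
  | cons : Val → Val → Val

namespace Val

/-- The first subtree (`nil` for `nil`). -/
def hd : Val → Val
  | nil => nil
  | cons x _ => x

/-- The second subtree (`nil` for `nil`). -/
def tl : Val → Val
  | nil => nil
  | cons _ y => y

/-- Lists as right-nested trees. -/
def ofList : List Val → Val
  | [] => nil
  | x :: l => cons x (ofList l)

/-- Natural numbers in unary. -/
def ofNat (n : ℕ) : Val := ofList (List.replicate n nil)

/-- A graph on `Fin a` with darts `Fin b`: the number `a`, and for each dart its vertex and its
partner under the involution. -/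
def ofGraph {a b : ℕ} (G : DartGraph (Fin a) (Fin b)) : Val :=
  cons (ofNat a)
    (ofList (List.ofFn fun d => cons (ofNat (G.vert d).val) (ofNat (G.inv d).val)))

/-- A matrix of natural numbers, as the list of its rows. -/
def ofMatrix {p q : ℕ} (M : Fin p → Fin q → ℕ) : Val :=
  ofList (List.ofFn fun i => ofList (List.ofFn fun j => ofNat (M i j)))

end Val

/-- Programs; variables are named by natural numbers. -/
inductive Prog where
  | setNil (x : ℕ) : Prog
  | setCons (x y z : ℕ) : Prog
  | setHd (x y : ℕ) : Prog
  | setTl (x y : ℕ) : Prog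
  | seq (P Q : Prog) : Prog
  | ite (x : ℕ) (P Q : Prog) : Prog
  | while (x : ℕ) (P : Prog) : Prog

/-- The contents of the variables. -/
abbrev Store := ℕ → Val

/-- The store that holds `v` in variable `0` and `nil` in all other variables. -/
def Store.single (v : Val) : Store := Function.update (fun _ => Val.nil) 0 v

/-- `Exec P s t s'`: started in store `s`, the program `P` halts after exactly `t` steps in
store `s'`. In tests, `nil` is false and every other tree is true. -/
inductive Exec : Prog → Store → ℕ → Store → Prop where
  | setNil (x : ℕ) (s : Store) : Exec (.setNil x) s 1 (Function.update s x Val.nil)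
  | setCons (x y z : ℕ) (s : Store) :
      Exec (.setCons x y z) s 1 (Function.update s x (Val.cons (s y) (s z)))
  | setHd (x y : ℕ) (s : Store) : Exec (.setHd x y) s 1 (Function.update s x (s y).hd)
  | setTl (x y : ℕ) (s : Store) : Exec (.setTl x y) s 1 (Function.update s x (s y).tl)
  | seq {P Q : Prog} {s s₁ s₂ : Store} {t₁ t₂ : ℕ} :
      Exec P s t₁ s₁ → Exec Q s₁ t₂ s₂ → Exec (.seq P Q) s (t₁ + t₂) s₂
  | iteTrue {x : ℕ} {P Q : Prog} {s s₁ : Store} {t : ℕ} :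
      s x ≠ Val.nil → Exec P s t s₁ → Exec (.ite x P Q) s (t + 1) s₁
  | iteFalse {x : ℕ} {P Q : Prog} {s s₁ : Store} {t : ℕ} :
      s x = Val.nil → Exec Q s t s₁ → Exec (.ite x P Q) s (t + 1) s₁
  | whileTrue {x : ℕ} {P : Prog} {s s₁ s₂ : Store} {t₁ t₂ : ℕ} :
      s x ≠ Val.nil → Exec P s t₁ s₁ → Exec (.while x P) s₁ t₂ s₂ →
      Exec (.while x P) s (t₁ + t₂ + 1) s₂
  | whileFalse {x : ℕ} {P : Prog} {s : Store} :
      s x = Val.nil → Exec (.while x P) s 1 s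

/-- On input `v` (in variable `0`) the program halts within `T` steps, and its answer (variable `0`
is not `nil`) is yes if and only if `A` holds. -/
def Prog.AnswersWithin (P : Prog) (v : Val) (A : Prop) (T : ℕ) : Prop :=
  ∃ (t : ℕ) (s : Store), Exec P (Store.single v) t s ∧ t ≤ T ∧ (s 0 ≠ Val.nil ↔ A)

/-- On input `v` the program halts within `T` steps with output `w` (in variable `0`, all other
variables being cleared). -/
def Prog.OutputsWithin (P : Prog) (v w : Val) (T : ℕ) : Prop :=
  ∃ t : ℕ, Exec P (Store.single v) t (Store.single w) ∧ t ≤ T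

/-- Decision problems whose instances are the finite graphs. -/
abbrev GraphProblem := ∀ ⦃a b : ℕ⦄, DartGraph (Fin a) (Fin b) → Prop

/-- The program decides the problem in time polynomial in the size of the input graph. -/
def Prog.SolvesInPolyTime (P : Prog) (A : GraphProblem) : Prop :=
  ∃ T : Polynomial ℕ, ∀ ⦃a b : ℕ⦄ (G : DartGraph (Fin a) (Fin b)),
    P.AnswersWithin (Val.ofGraph G) (A G) (T.eval G.size)

/-- The problem is polynomial-time solvable. -/
def PolyTimeSolvable (A : GraphProblem) : Prop := ∃ P : Prog, P.SolvesInPolyTime A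

/-- The problem `H`-Cover, for a fixed connected graph `H`: does the input graph cover `H`? -/
def CoverProblem {V D : Type*} (H : DartGraph V D) : GraphProblem :=
  fun _ _ G => G.Covers H

/-- The problem `H`-EquitableCover, for a fixed graph `H`: does the input graph equitably cover
`H`? -/
def EquitableCoverProblem {V D : Type*} (H : DartGraph V D) : GraphProblem :=
  fun _ _ G => G.EquitablyCovers H

/-- The covering pattern as program data, for given numberings of the components. -/
noncomputable def Val.ofCovPattern {V D V' D' : Type*} (G : DartGraph V D) (H : DartGraph V' D')
    {p q : ℕ} (g : Fin p ≃ G.Component) (h : Fin q ≃ H.Component) : Val :=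
  Val.ofMatrix fun i j => G.covPattern H (g i) (h j)

/-! A covering projection onto a connected graph has vertex fibres of constant size. Over each dart
`d` there is exactly one dart at every vertex above `H.vert d`, and the involution exchanges the
fibres of `d` and `H.inv d`; so the fibres over the two ends of a link are equally large, and
connectedness does the rest (`ncard_fiber_eq`). Hence a component `G_i` mapped onto `H_j`
contributes exactly `r_ij` preimages to every vertex of `H_j`, and conversely coverings chosen
separately on the components glue together. So `G` equitably covers `H` if and only if one positive
entry can be chosen in each row of the weight matrix such that the chosen entries have the same sum
in every column (`equitablyCovers_iff`).

This is decided by a dynamic program. Fix a base `M` larger than the sum of all weights; then `M` is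
`O(n)` for fixed `q`, because every column sums to at most `n`. A vector of column sums is stored as
one number with these sums as base-`M` digits; there are no carries, so the number determines the
vector. The set of reachable numbers is a truth-value list of length at most `M ^ q`. Each of the at
most `n` rows replaces it by a union of `q` shifted copies at cost `O(n ^ q)`, for a total of `O(n ^
(q + 1))`. The answer is yes when some multiple `k * (1 + M + ... + M ^ (q - 1))` with `k < M` is
reachable (`MCtx.solvable_iff`, `MCtx.comp_solvable`).

The pattern itself is obtained by labelling the vertices by components, extracting each component as
a renumbered graph, running the assumed solvers on it and dividing vertex counts by constants
(`GCtx.pcomp_covPattern`).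

Running times are handled compositionally: `Comp N k env e` is closed under constructors, branching
and bounded loops, and a loop of `O(N ^ d)` rounds adds `d` to the exponent of its body. `PComp`
forgets the exponent; the second program keeps track of it. -/

/-! ### Time-bounded execution -/

/-- `P` runs from `s` to `s'` in at most `T` steps. -/
def Prog.Runs (P : Prog) (s : Store) (T : ℕ) (s' : Store) : Prop := ∃ t ≤ T, Exec P s t s'

namespace Prog

theorem Runs.seq {P Q : Prog} {s s₁ s₂ : Store} {T₁ T₂ : ℕ} (h₁ : P.Runs s T₁ s₁)
    (h₂ : Q.Runs s₁ T₂ s₂) : (Prog.seq P Q).Runs s (T₁ + T₂) s₂ := by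
  obtain ⟨t₁, ht₁, e₁⟩ := h₁
  obtain ⟨t₂, ht₂, e₂⟩ := h₂
  exact ⟨_, Nat.add_le_add ht₁ ht₂, .seq e₁ e₂⟩

theorem Runs.mono {P : Prog} {s s' : Store} {T T' : ℕ} (h : P.Runs s T s') (hT : T ≤ T') :
    P.Runs s T' s' := by
  obtain ⟨t, ht, e⟩ := h
  exact ⟨t, ht.trans hT, e⟩

theorem runs_setNil (x : ℕ) (s : Store) :
    (setNil x).Runs s 1 (Function.update s x Val.nil) := ⟨1, le_rfl, .setNil x s⟩

theorem runs_setCons (x y z : ℕ) (s : Store) :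
    (setCons x y z).Runs s 1 (Function.update s x (Val.cons (s y) (s z))) :=
  ⟨1, le_rfl, .setCons x y z s⟩

theorem runs_setHd (x y : ℕ) (s : Store) :
    (setHd x y).Runs s 1 (Function.update s x (s y).hd) := ⟨1, le_rfl, .setHd x y s⟩

theorem runs_setTl (x y : ℕ) (s : Store) :
    (setTl x y).Runs s 1 (Function.update s x (s y).tl) := ⟨1, le_rfl, .setTl x y s⟩

/-- Assign the value of `y` to `x`. -/
def copy (x y : ℕ) : Prog := seq (setCons x y y) (setHd x x)

theorem runs_copy (x y : ℕ) (s : Store) : (copy x y).Runs s 2 (Function.update s x (s y)) := by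
  have := (runs_setCons x y y s).seq (runs_setHd x x _)
  simpa [copy, Val.hd] using this

theorem Runs.iteTrue {x : ℕ} {P Q : Prog} {s s' : Store} {T : ℕ} (hx : s x ≠ Val.nil)
    (h : P.Runs s T s') : (ite x P Q).Runs s (T + 1) s' := by
  obtain ⟨t, ht, e⟩ := h
  exact ⟨t + 1, by omega, .iteTrue hx e⟩

theorem Runs.iteFalse {x : ℕ} {P Q : Prog} {s s' : Store} {T : ℕ} (hx : s x = Val.nil)
    (h : Q.Runs s T s') : (ite x P Q).Runs s (T + 1) s' := by
  obtain ⟨t, ht, e⟩ := h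
  exact ⟨t + 1, by omega, .iteFalse hx e⟩

theorem Runs.whileTrue {x : ℕ} {P : Prog} {s s₁ s₂ : Store} {T₁ T₂ : ℕ} (hx : s x ≠ Val.nil)
    (h₁ : P.Runs s T₁ s₁) (h₂ : (Prog.while x P).Runs s₁ T₂ s₂) :
    (Prog.while x P).Runs s (T₁ + T₂ + 1) s₂ := by
  obtain ⟨t₁, ht₁, e₁⟩ := h₁
  obtain ⟨t₂, ht₂, e₂⟩ := h₂
  exact ⟨_, by omega, .whileTrue hx e₁ e₂⟩

theorem runs_while_nil {x : ℕ} {P : Prog} {s : Store} (hx : s x = Val.nil) :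
    (Prog.while x P).Runs s 1 s := ⟨1, le_rfl, .whileFalse hx⟩

/-! ### Independence of unused variables, and clearing. -/

/-- A strict upper bound for the variables of a program. -/
def bound : Prog → ℕ
  | setNil x => x + 1
  | setCons x y z => max (x + 1) (max (y + 1) (z + 1))
  | setHd x y => max (x + 1) (y + 1)
  | setTl x y => max (x + 1) (y + 1)
  | seq P Q => max P.bound Q.bound
  | ite x P Q => max (x + 1) (max P.bound Q.bound)
  | .while x P => max (x + 1) P.bound

end Prog

theorem Function.update_agree {m x : ℕ} {s u : Store} (h : ∀ y < m, u y = s y) (v : Val) :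
    ∀ y < m, Function.update u x v y = Function.update s x v y := by
  intro y hy
  by_cases hyx : y = x
  · subst hyx; simp
  · simp [hyx, h y hy]

/-- An execution depends only on the variables of the program and leaves the others alone. -/
theorem Exec.transfer {P : Prog} {s s' : Store} {t : ℕ} (h : Exec P s t s') {m : ℕ} :
    ∀ {u : Store}, P.bound ≤ m → (∀ x < m, u x = s x) →
      ∃ u', Exec P u t u' ∧ (∀ x < m, u' x = s' x) ∧ ∀ x, m ≤ x → u' x = u x := by
  induction h with
  | setNil x s =>
    intro u hm hu
    simp only [Prog.bound] at hm
    exact ⟨_, .setNil x u, Function.update_agree hu _,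
      fun y hy => Function.update_of_ne (by omega) _ _⟩
  | setCons x y z s =>
    intro u hm hu
    simp only [Prog.bound, max_le_iff] at hm
    refine ⟨_, .setCons x y z u, ?_, fun y hy => Function.update_of_ne (by omega) _ _⟩
    rw [hu y (by omega), hu z (by omega)]
    exact Function.update_agree hu _
  | setHd x y s =>
    intro u hm hu
    simp only [Prog.bound, max_le_iff] at hm
    refine ⟨_, .setHd x y u, ?_, fun y hy => Function.update_of_ne (by omega) _ _⟩
    rw [hu y (by omega)]
    exact Function.update_agree hu _
  | setTl x y s =>
    intro u hm hu
    simp only [Prog.bound, max_le_iff] at hm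
    refine ⟨_, .setTl x y u, ?_, fun y hy => Function.update_of_ne (by omega) _ _⟩
    rw [hu y (by omega)]
    exact Function.update_agree hu _
  | seq _ _ ih₁ ih₂ =>
    intro u hm hu
    simp only [Prog.bound, max_le_iff] at hm
    obtain ⟨u₁, e₁, a₁, b₁⟩ := ih₁ hm.1 hu
    obtain ⟨u₂, e₂, a₂, b₂⟩ := ih₂ hm.2 a₁
    exact ⟨u₂, .seq e₁ e₂, a₂, fun x hx => (b₂ x hx).trans (b₁ x hx)⟩
  | iteTrue hx _ ih =>
    intro u hm hu
    simp only [Prog.bound, max_le_iff] at hm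
    obtain ⟨u₁, e₁, a₁, b₁⟩ := ih hm.2.1 hu
    exact ⟨u₁, .iteTrue (by rwa [hu _ (by omega)]) e₁, a₁, b₁⟩
  | iteFalse hx _ ih =>
    intro u hm hu
    simp only [Prog.bound, max_le_iff] at hm
    obtain ⟨u₁, e₁, a₁, b₁⟩ := ih hm.2.2 hu
    exact ⟨u₁, .iteFalse (by rwa [hu _ (by omega)]) e₁, a₁, b₁⟩
  | whileTrue hx _ _ ih₁ ih₂ =>
    intro u hm hu
    obtain ⟨u₁, e₁, a₁, b₁⟩ := ih₁ (by simp only [Prog.bound, max_le_iff] at hm; omega) hu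
    obtain ⟨u₂, e₂, a₂, b₂⟩ := ih₂ hm a₁
    simp only [Prog.bound, max_le_iff] at hm
    exact ⟨u₂, .whileTrue (by rwa [hu _ (by omega)]) e₁ e₂, a₂,
      fun x hx => (b₂ x hx).trans (b₁ x hx)⟩
  | whileFalse hx =>
    intro u hm hu
    simp only [Prog.bound, max_le_iff] at hm
    exact ⟨u, .whileFalse (by rwa [hu _ (by omega)]), hu, fun _ _ => rfl⟩

/-- Clear the variables `1, …, m`. -/
def Prog.clear : ℕ → Prog
  | 0 => copy 0 0
  | m + 1 => seq (clear m) (setNil (m + 1))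

/-- The budget is one step per cleared variable plus the two steps of `copy 0 0`, which serves as a
program without effect. -/
theorem Prog.runs_clear (m : ℕ) (s : Store) :
    ∃ s', (clear m).Runs s (m + 2) s' ∧ s' 0 = s 0 ∧ (∀ x, 1 ≤ x → x ≤ m → s' x = Val.nil) ∧
      ∀ x, m < x → s' x = s x := by
  induction m with
  | zero =>
    refine ⟨_, runs_copy 0 0 s, by simp, fun x _ _ => by omega, fun x hx => ?_⟩
    exact Function.update_of_ne (by omega) _ _
  | succ m ih =>
    obtain ⟨s', hr, h0, h1, h2⟩ := ih
    refine ⟨_, hr.seq (runs_setNil (m + 1) s'), ?_, fun x hx hm => ?_, fun x hx => ?_⟩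
    · rw [Function.update_of_ne (by omega), h0]
    · rcases eq_or_ne x (m + 1) with rfl | hne
      · simp
      · rw [Function.update_of_ne hne, h1 x hx (by omega)]
    · rw [Function.update_of_ne (by omega), h2 x (by omega)]

/-! ### Expressions computable from an environment -/

/-- `Comp N k env e`: one program computes `e γ` from `env γ`, for all contexts `γ`, in time
`O((N γ + 1) ^ k)`; it uses finitely many variables and needs none of them to be cleared. -/
def Comp {Γ : Type} (N : Γ → ℕ) (k : ℕ) (env e : Γ → Val) : Prop :=
  ∃ (P : Prog) (m C : ℕ), ∀ (γ : Γ) (s : Store), s 0 = env γ →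
    ∃ s', P.Runs s (C * (N γ + 1) ^ k) s' ∧ s' 0 = e γ ∧ ∀ x, m ≤ x → s' x = s x

/-- A position in a list that depends on a context. -/
structure LCtx {Γ : Type} {α : Γ → Type} (l : ∀ γ, List (α γ)) where
  base : Γ
  pre : List (α base)
  x : α base
  post : List (α base)
  eq : l base = pre ++ x :: post

theorem LCtx.mem {Γ : Type} {α : Γ → Type} {l : ∀ γ, List (α γ)} (p : LCtx l) :
    p.x ∈ l p.base := by
  rw [p.eq]; simp

namespace Comp

variable {Γ Γ' : Type} {N : Γ → ℕ} {k : ℕ} {env e e₁ e₂ : Γ → Val}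

theorem one_le_pow' (n k : ℕ) : 1 ≤ (n + 1) ^ k := Nat.one_le_pow _ _ (by omega)

theorem mono {k' : ℕ} (h : Comp N k env e) (hk : k ≤ k') : Comp N k' env e := by
  obtain ⟨P, m, C, hP⟩ := h
  refine ⟨P, m, C, fun γ s hs => ?_⟩
  obtain ⟨s', h1, h2⟩ := hP γ s hs
  exact ⟨s', h1.mono (Nat.mul_le_mul_left _ (Nat.pow_le_pow_right (by omega) hk)), h2⟩

/-- The program stays the same; only the family of contexts is pulled back. This lets a program
built for one kind of context be used inside another. -/
theorem reindex (h : Comp N k env e) (φ : Γ' → Γ) :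
    Comp (fun p => N (φ p)) k (fun p => env (φ p)) (fun p => e (φ p)) := by
  obtain ⟨P, m, C, hP⟩ := h
  exact ⟨P, m, C, fun p => hP (φ p)⟩

theorem congr {env' e' : Γ → Val} (h : Comp N k env e) (h1 : ∀ γ, env γ = env' γ)
    (h2 : ∀ γ, e γ = e' γ) : Comp N k env' e' := by
  obtain rfl := funext h1
  obtain rfl := funext h2
  exact h

/-- Substituting one size bound into another multiplies exponents, and `c ^ k` is absorbed into the
constant. This pays for running a program on derived data. -/
theorem change {N' : Γ → ℕ} {c d : ℕ} (h : Comp N k env e)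
    (hN : ∀ γ, N γ + 1 ≤ c * (N' γ + 1) ^ d) : Comp N' (d * k) env e := by
  obtain ⟨P, m, C, hP⟩ := h
  refine ⟨P, m, C * c ^ k, fun γ s hs => ?_⟩
  obtain ⟨s', h1, h2⟩ := hP γ s hs
  refine ⟨s', h1.mono ?_, h2⟩
  rw [mul_assoc, pow_mul, ← mul_pow]
  exact Nat.mul_le_mul_left _ (Nat.pow_le_pow_left (hN γ) _)

theorem id : Comp N k env env :=
  ⟨.copy 0 0, 1, 2, fun γ s hs => ⟨_, (Prog.runs_copy 0 0 s).mono
    (by have := one_le_pow' (N γ) k; omega), by simpa using hs, fun x hx => by simp⟩⟩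

theorem comp (h₁ : Comp N k env e₁) (h₂ : Comp N k e₁ e₂) : Comp N k env e₂ := by
  obtain ⟨P, m, C, hP⟩ := h₁
  obtain ⟨Q, m', C', hQ⟩ := h₂
  refine ⟨.seq P Q, max m m', C + C', fun γ s hs => ?_⟩
  obtain ⟨s₁, r₁, a₁, b₁⟩ := hP γ s hs
  obtain ⟨s₂, r₂, a₂, b₂⟩ := hQ γ s₁ a₁
  refine ⟨s₂, (r₁.seq r₂).mono (by rw [add_mul]), a₂, fun x hx => ?_⟩
  rw [b₂ x (by omega), b₁ x (by omega)]

theorem nil : Comp N k env (fun _ => Val.nil) :=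
  ⟨.setNil 0, 1, 1, fun γ s _ => ⟨_, (Prog.runs_setNil 0 s).mono
    (by have := one_le_pow' (N γ) k; omega), by simp, fun x hx =>
      Function.update_of_ne (by omega) _ _⟩⟩

theorem hd (h : Comp N k env e) : Comp N k env (fun γ => (e γ).hd) :=
  h.comp ⟨.setHd 0 0, 1, 1, fun γ s hs => ⟨_, (Prog.runs_setHd 0 0 s).mono
    (by have := one_le_pow' (N γ) k; omega), by simp [hs], fun x hx =>
      Function.update_of_ne (by omega) _ _⟩⟩

theorem tl (h : Comp N k env e) : Comp N k env (fun γ => (e γ).tl) :=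
  h.comp ⟨.setTl 0 0, 1, 1, fun γ s hs => ⟨_, (Prog.runs_setTl 0 0 s).mono
    (by have := one_le_pow' (N γ) k; omega), by simp [hs], fun x hx =>
      Function.update_of_ne (by omega) _ _⟩⟩

theorem cons (h₁ : Comp N k env e₁) (h₂ : Comp N k env e₂) :
    Comp N k env (fun γ => Val.cons (e₁ γ) (e₂ γ)) := by
  obtain ⟨P, m, C, hP⟩ := h₁
  obtain ⟨Q, m', C', hQ⟩ := h₂
  -- Registers `a` and `a + 1` are untouched by both programs and differ from register `0`: `a`
  -- keeps the environment and `a + 1` the first value.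
  obtain ⟨a, ha⟩ : ∃ a, a = max m m' + 1 := ⟨_, rfl⟩
  refine ⟨.seq (.copy a 0) (.seq P (.seq (.copy (a + 1) 0) (.seq (.copy 0 a)
    (.seq Q (.setCons 0 (a + 1) 0))))), a + 2, C + C' + 7, fun γ s hs => ?_⟩
  have r₁ := Prog.runs_copy a 0 s
  obtain ⟨s₂, r₂, a₂, b₂⟩ := hP γ (Function.update s a (s 0))
    (by rw [Function.update_of_ne (by omega), hs])
  have r₃ := Prog.runs_copy (a + 1) 0 s₂
  have r₄ := Prog.runs_copy 0 a (Function.update s₂ (a + 1) (s₂ 0))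
  obtain ⟨s₅, r₅, a₅, b₅⟩ := hQ γ _ (show Function.update (Function.update s₂ (a + 1) (s₂ 0)) 0
    (Function.update s₂ (a + 1) (s₂ 0) a) 0 = env γ by
      rw [Function.update_self, Function.update_of_ne (by omega), b₂ a (by omega)]
      simp [hs])
  have r₆ := Prog.runs_setCons 0 (a + 1) 0 s₅
  refine ⟨_, (r₁.seq (r₂.seq (r₃.seq (r₄.seq (r₅.seq r₆))))).mono ?_, ?_, fun x hx => ?_⟩
  · have := one_le_pow' (N γ) k
    nlinarith
  · rw [Function.update_self, a₅, b₅ (a + 1) (by omega), Function.update_of_ne (by omega),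
      Function.update_self, a₂]
  · rw [Function.update_of_ne (by omega), b₅ x (by omega), Function.update_of_ne (by omega),
      Function.update_of_ne (by omega), b₂ x (by omega), Function.update_of_ne (by omega)]

/-- Case distinction; each branch has to work only in the contexts in which it is taken. -/
theorem ite' {c : Γ → Val} (hc : Comp N k env c)
    (h₁ : Comp (Γ := {γ // c γ ≠ Val.nil}) (fun γ => N γ) k (fun γ => env γ) (fun γ => e γ))
    (h₂ : Comp (Γ := {γ // c γ = Val.nil}) (fun γ => N γ) k (fun γ => env γ) (fun γ => e γ)) :
    Comp N k env e := by
  obtain ⟨P, m, C, hP⟩ := hc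
  obtain ⟨P₁, m₁, C₁, hP₁⟩ := h₁
  obtain ⟨P₂, m₂, C₂, hP₂⟩ := h₂
  obtain ⟨a, ha⟩ : ∃ a, a = max m (max m₁ m₂) + 1 := ⟨_, rfl⟩
  refine ⟨.seq (.copy a 0) (.seq P (.seq (.copy (a + 1) 0) (.seq (.copy 0 a)
    (.ite (a + 1) P₁ P₂)))), a + 2, C + C₁ + C₂ + 7, fun γ s hs => ?_⟩
  have r₁ := Prog.runs_copy a 0 s
  obtain ⟨s₂, r₂, a₂, b₂⟩ := hP γ (Function.update s a (s 0))
    (by rw [Function.update_of_ne (by omega), hs])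
  have r₃ := Prog.runs_copy (a + 1) 0 s₂
  have r₄ := Prog.runs_copy 0 a (Function.update s₂ (a + 1) (s₂ 0))
  obtain ⟨s₄, hs₄⟩ : ∃ s₄, s₄ = Function.update (Function.update s₂ (a + 1) (s₂ 0)) 0
    (Function.update s₂ (a + 1) (s₂ 0) a) := ⟨_, rfl⟩
  rw [← hs₄] at r₄
  have h0 : s₄ 0 = env γ := by
    rw [hs₄, Function.update_self, Function.update_of_ne (by omega), b₂ a (by omega)]
    simp [hs]
  have h1 : s₄ (a + 1) = c γ := by
    rw [hs₄, Function.update_of_ne (by omega), Function.update_self, a₂]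
  have hX := one_le_pow' (N γ) k
  have hrest : ∀ x, a + 2 ≤ x → s₄ x = s x := fun x hx => by
    rw [hs₄, Function.update_of_ne (by omega), Function.update_of_ne (by omega), b₂ x (by omega),
      Function.update_of_ne (by omega)]
  by_cases hcγ : c γ = Val.nil
  · obtain ⟨s₅, r₅, a₅, b₅⟩ := hP₂ ⟨γ, hcγ⟩ s₄ h0
    have r₆ := r₅.iteFalse (P := P₁) (x := a + 1) (by rw [h1, hcγ])
    refine ⟨s₅, (r₁.seq (r₂.seq (r₃.seq (r₄.seq r₆)))).mono ?_, a₅, fun x hx => ?_⟩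
    · dsimp only; nlinarith
    · rw [b₅ x (by omega), hrest x hx]
  · obtain ⟨s₅, r₅, a₅, b₅⟩ := hP₁ ⟨γ, hcγ⟩ s₄ h0
    have r₆ := r₅.iteTrue (Q := P₂) (x := a + 1) (by rwa [h1])
    refine ⟨s₅, (r₁.seq (r₂.seq (r₃.seq (r₄.seq r₆)))).mono ?_, a₅, fun x hx => ?_⟩
    · dsimp only; nlinarith
    · rw [b₅ x (by omega), hrest x hx]

theorem ite {q : Γ → Prop} [DecidablePred q] {c : Γ → Val} (hc : Comp N k env c)
    (hq : ∀ γ, c γ ≠ Val.nil ↔ q γ) (h₁ : Comp N k env e₁) (h₂ : Comp N k env e₂) :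
    Comp N k env (fun γ => if q γ then e₁ γ else e₂ γ) :=
  hc.ite' ((h₁.reindex Subtype.val).congr (fun _ => rfl) fun γ => by
      simp [(hq _).1 γ.2]) ((h₂.reindex Subtype.val).congr (fun _ => rfl) fun γ => by
      have : ¬ q γ := fun h => (hq _).2 h γ.2
      simp [this])

/-- `F γ pre` is the loop invariant: the state after the prefix `pre`. The body is treated as an
expression over positions in the list, so it has to be correct only for prefixes that really occur,
and its time is measured by the size of the base context. -/
theorem loop {α : Γ → Type} {l : ∀ γ, List (α γ)} {enc : ∀ γ, α γ → Val}
    {F : ∀ γ, List (α γ) → Val} {d c : ℕ} (hlen : ∀ γ, (l γ).length ≤ c * (N γ + 1) ^ d)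
    (h : Comp (fun p : LCtx l => N p.base) k
      (fun p => Val.cons (env p.base) (Val.cons (enc _ p.x) (F _ p.pre)))
      (fun p => F _ (p.pre ++ [p.x]))) :
    Comp N (d + k)
      (fun γ => Val.cons (env γ) (Val.cons (Val.ofList ((l γ).map (enc γ))) (F γ [])))
      (fun γ => F γ (l γ)) := by
  obtain ⟨P, m, C, hP⟩ := h
  obtain ⟨a, ha⟩ : ∃ a, a = m + 1 := ⟨_, rfl⟩
  -- variables: `a` environment, `a + 1` remaining list, `a + 2` state
  let B : Prog := .seq (.setHd 0 (a + 1)) (.seq (.setCons 0 0 (a + 2)) (.seq (.setCons 0 a 0)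
    (.seq P (.seq (.copy (a + 2) 0) (.setTl (a + 1) (a + 1))))))
  -- Induction on the unprocessed suffix. A round costs the run of `P`, six further steps and one
  -- test; the final `1` is the failing test.
  have key : ∀ (γ : Γ) (post pre : List (α γ)), l γ = pre ++ post → ∀ s : Store, s a = env γ →
      s (a + 1) = Val.ofList (post.map (enc γ)) → s (a + 2) = F γ pre →
      ∃ s', (Prog.while (a + 1) B).Runs s (post.length * (C * (N γ + 1) ^ k + 7) + 1) s' ∧
        s' (a + 2) = F γ (l γ) ∧ ∀ x, a + 3 ≤ x → s' x = s x := by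
    intro γ post
    induction post with
    | nil =>
      intro pre hl s _ h1 h2
      exact ⟨s, (Prog.runs_while_nil (by simpa [Val.ofList] using h1)).mono (by omega),
        by rw [h2, hl, List.append_nil], fun _ _ => rfl⟩
    | cons x post ih =>
      intro pre hl s h0 h1 h2
      have r₁ := Prog.runs_setHd 0 (a + 1) s
      obtain ⟨s₁, e₁⟩ : ∃ s₁, s₁ = Function.update s 0 (s (a + 1)).hd := ⟨_, rfl⟩
      rw [← e₁] at r₁
      have r₂ := Prog.runs_setCons 0 0 (a + 2) s₁
      obtain ⟨s₂, e₂⟩ : ∃ s₂, s₂ = Function.update s₁ 0 ((s₁ 0).cons (s₁ (a + 2))) := ⟨_, rfl⟩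
      rw [← e₂] at r₂
      have r₃ := Prog.runs_setCons 0 a 0 s₂
      obtain ⟨s₃, e₃⟩ : ∃ s₃, s₃ = Function.update s₂ 0 ((s₂ a).cons (s₂ 0)) := ⟨_, rfl⟩
      rw [← e₃] at r₃
      have v₁ : ∀ x, x ≠ 0 → s₁ x = s x := fun x hx => by rw [e₁, Function.update_of_ne hx]
      have v₂ : ∀ x, x ≠ 0 → s₂ x = s x := fun x hx => by
        rw [e₂, Function.update_of_ne hx, v₁ x hx]
      have v₃ : ∀ x, x ≠ 0 → s₃ x = s x := fun x hx => by
        rw [e₃, Function.update_of_ne hx, v₂ x hx]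
      have w₁ : s₁ 0 = enc γ x := by
        rw [e₁, Function.update_self, h1]; rfl
      have w₂ : s₂ 0 = Val.cons (enc γ x) (F γ pre) := by
        rw [e₂, Function.update_self, w₁, v₁ _ (by omega), h2]
      have w₃ : s₃ 0 = Val.cons (env γ) (Val.cons (enc γ x) (F γ pre)) := by
        rw [e₃, Function.update_self, w₂, v₂ _ (by omega), h0]
      obtain ⟨s₄, r₄, a₄, b₄⟩ := hP ⟨γ, pre, x, post, hl⟩ s₃ w₃
      have r₅ := Prog.runs_copy (a + 2) 0 s₄
      have r₆ := Prog.runs_setTl (a + 1) (a + 1) (Function.update s₄ (a + 2) (s₄ 0))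
      obtain ⟨s₆, e₆⟩ : ∃ s₆, s₆ = Function.update (Function.update s₄ (a + 2) (s₄ 0)) (a + 1)
        (Function.update s₄ (a + 2) (s₄ 0) (a + 1)).tl := ⟨_, rfl⟩
      rw [← e₆] at r₆
      obtain ⟨s₇, r₇, a₇, b₇⟩ := ih (pre ++ [x]) (by rw [hl]; simp) s₆
        (by rw [e₆, Function.update_of_ne (by omega), Function.update_of_ne (by omega),
              b₄ a (by omega), v₃ a (by omega), h0])
        (by rw [e₆, Function.update_self, Function.update_of_ne (by omega), b₄ _ (by omega),
              v₃ _ (by omega), h1]; rfl)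
        (by rw [e₆, Function.update_of_ne (by omega), Function.update_self, a₄])
      have r : B.Runs s _ s₆ := r₁.seq (r₂.seq (r₃.seq (r₄.seq (r₅.seq r₆))))
      refine ⟨s₇, (r.whileTrue (x := a + 1) (by rw [h1]; simp [Val.ofList]) r₇).mono ?_, a₇,
        fun y hy => ?_⟩
      · rw [List.length_cons, add_mul]; dsimp only; omega
      · rw [b₇ y hy, e₆, Function.update_of_ne (by omega), Function.update_of_ne (by omega),
          b₄ y (by omega), v₃ y (by omega)]
  refine ⟨.seq (.setHd a 0) (.seq (.setTl 0 0) (.seq (.setHd (a + 1) 0) (.seq (.setTl (a + 2) 0)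
    (.seq (.while (a + 1) B) (.copy 0 (a + 2)))))), a + 3, c * (C + 7) + 7, fun γ s hs => ?_⟩
  have r₁ := Prog.runs_setHd a 0 s
  have r₂ := Prog.runs_setTl 0 0 (Function.update s a (s 0).hd)
  obtain ⟨s₂, e₂⟩ : ∃ s₂, s₂ = Function.update (Function.update s a (s 0).hd) 0
    (Function.update s a (s 0).hd 0).tl := ⟨_, rfl⟩
  rw [← e₂] at r₂
  have r₃ := Prog.runs_setHd (a + 1) 0 s₂
  have r₄ := Prog.runs_setTl (a + 2) 0 (Function.update s₂ (a + 1) (s₂ 0).hd)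
  obtain ⟨s₄, e₄⟩ : ∃ s₄, s₄ = Function.update (Function.update s₂ (a + 1) (s₂ 0).hd) (a + 2)
    (Function.update s₂ (a + 1) (s₂ 0).hd 0).tl := ⟨_, rfl⟩
  rw [← e₄] at r₄
  have w₂ : s₂ 0 = Val.cons (Val.ofList ((l γ).map (enc γ))) (F γ []) := by
    rw [e₂, Function.update_self, Function.update_of_ne (by omega), hs]; rfl
  obtain ⟨s₅, r₅, a₅, b₅⟩ := key γ (l γ) [] rfl s₄
    (by rw [e₄, Function.update_of_ne (by omega), Function.update_of_ne (by omega), e₂,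
          Function.update_of_ne (by omega), Function.update_self, hs]; rfl)
    (by rw [e₄, Function.update_of_ne (by omega), Function.update_self, w₂]; rfl)
    (by rw [e₄, Function.update_self, Function.update_of_ne (by omega), w₂]; rfl)
  have r₆ := Prog.runs_copy 0 (a + 2) s₅
  refine ⟨_, (r₁.seq (r₂.seq (r₃.seq (r₄.seq (r₅.seq r₆))))).mono ?_, ?_, fun x hx => ?_⟩
  · have h1 := one_le_pow' (N γ) k
    have h2 := one_le_pow' (N γ) d
    have h3 : (l γ).length * (C * (N γ + 1) ^ k + 7) ≤
        (c * (N γ + 1) ^ d) * ((C + 7) * (N γ + 1) ^ k) :=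
      Nat.mul_le_mul (hlen γ) (by nlinarith)
    have h4 := one_le_pow' (N γ) (d + k)
    have h5 : (c * (C + 7) + 7) * (N γ + 1) ^ (d + k) =
      (c * (N γ + 1) ^ d) * ((C + 7) * (N γ + 1) ^ k) + 7 * (N γ + 1) ^ (d + k) := by
      rw [pow_add]; ring
    omega
  · rw [Function.update_self, a₅]
  · rw [Function.update_of_ne (by omega), b₅ x hx, e₄, Function.update_of_ne (by omega),
      Function.update_of_ne (by omega), e₂, Function.update_of_ne (by omega),
      Function.update_of_ne (by omega)]

theorem foldl {α : Γ → Type} {l : ∀ γ, List (α γ)} {enc : ∀ γ, α γ → Val}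
    {F : ∀ γ, List (α γ) → Val} {d c : ℕ} (hlen : ∀ γ, (l γ).length ≤ c * (N γ + 1) ^ d)
    (hl : Comp N (d + k) env (fun γ => Val.ofList ((l γ).map (enc γ))))
    (h₀ : Comp N (d + k) env (fun γ => F γ []))
    (h : Comp (fun p : LCtx l => N p.base) k
      (fun p => Val.cons (env p.base) (Val.cons (enc _ p.x) (F _ p.pre)))
      (fun p => F _ (p.pre ++ [p.x]))) :
    Comp N (d + k) env (fun γ => F γ (l γ)) :=
  (id.cons (hl.cons h₀)).comp (loop hlen h)

theorem const (v : Val) : Comp N k env (fun _ => v) := by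
  induction v with
  | nil => exact nil
  | cons x y hx hy => exact hx.cons hy

/-- An expression over the base context, in an extended context. -/
theorem wk (h : Comp N k env e) (φ : Γ' → Γ) (r : Γ' → Val) :
    Comp (fun p => N (φ p)) k (fun p => Val.cons (env (φ p)) (r p)) (fun p => e (φ p)) :=
  (id (env := fun p => Val.cons (env (φ p)) (r p))).hd.comp (h.reindex φ)

theorem reverse {α : Γ → Type} {l : ∀ γ, List (α γ)} {enc : ∀ γ, α γ → Val}
    {d c : ℕ} (hlen : ∀ γ, (l γ).length ≤ c * (N γ + 1) ^ d)
    (hl : Comp N (d + k) env (fun γ => Val.ofList ((l γ).map (enc γ)))) :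
    Comp N (d + k) env (fun γ => Val.ofList ((l γ).reverse.map (enc γ))) :=
  foldl (F := fun γ l => Val.ofList (l.reverse.map (enc γ))) hlen hl nil
    ((id.tl.hd.cons id.tl.tl).congr (fun _ => rfl) fun p => by simp [Val.ofList, Val.hd, Val.tl])

/-- A left fold over the reversed list; a position there is a position of the original list with
prefix and suffix interchanged and reversed. -/
theorem foldr {α : Γ → Type} {l : ∀ γ, List (α γ)} {enc : ∀ γ, α γ → Val}
    {F : ∀ γ, List (α γ) → Val} {d c : ℕ} (hlen : ∀ γ, (l γ).length ≤ c * (N γ + 1) ^ d)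
    (hl : Comp N (d + k) env (fun γ => Val.ofList ((l γ).map (enc γ))))
    (h₀ : Comp N (d + k) env (fun γ => F γ []))
    (h : Comp (fun p : LCtx l => N p.base) k
      (fun p => Val.cons (env p.base) (Val.cons (enc _ p.x) (F _ p.post)))
      (fun p => F _ (p.x :: p.post))) :
    Comp N (d + k) env (fun γ => F γ (l γ)) := by
  have := foldl (l := fun γ => (l γ).reverse) (F := fun γ l => F γ l.reverse)
    (fun γ => by simpa using hlen γ) (reverse hlen hl) h₀
    ((h.reindex (fun p : LCtx fun γ => (l γ).reverse =>
      (⟨p.base, p.post.reverse, p.x, p.pre.reverse, by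
        have := congrArg List.reverse p.eq
        simpa using this⟩ : LCtx l))).congr (fun p => rfl) fun p => by simp)
  simpa using this

end Comp

/-! ### Library of computable expressions -/

namespace Val

/-- Truth values. -/
def ofBool (b : Bool) : Val := if b then cons nil nil else nil

theorem ofBool_ne_nil {b : Bool} : ofBool b ≠ nil ↔ b = true := by
  cases b <;> simp [ofBool]

@[simp] theorem ofNat_zero : ofNat 0 = nil := rfl

theorem ofNat_succ (n : ℕ) : ofNat (n + 1) = cons nil (ofNat n) := rfl

theorem ofNat_ne_nil {n : ℕ} : ofNat n ≠ nil ↔ n ≠ 0 := by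
  cases n <;> simp [ofNat_succ]

@[simp] theorem tl_ofNat (n : ℕ) : (ofNat n).tl = ofNat (n - 1) := by
  cases n <;> rfl

@[simp] theorem hd_cons (x y : Val) : (cons x y).hd = x := rfl

@[simp] theorem tl_cons (x y : Val) : (cons x y).tl = y := rfl

@[simp] theorem ofList_nil : ofList [] = nil := rfl

@[simp] theorem ofList_cons (x : Val) (l : List Val) : ofList (x :: l) = cons x (ofList l) := rfl

theorem tl_ofList (l : List Val) : (ofList l).tl = ofList l.tail := by
  cases l <;> rfl

end Val

/-- A number below a bound that depends on a context. -/
structure NCtx {Γ : Type} (n : Γ → ℕ) where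
  base : Γ
  i : ℕ
  lt : i < n base

namespace Comp

variable {Γ : Type} {N : Γ → ℕ} {k d c : ℕ} {env e e₁ e₂ : Γ → Val}

theorem succ {n : Γ → ℕ} (h : Comp N k env (fun γ => Val.ofNat (n γ))) :
    Comp N k env (fun γ => Val.ofNat (n γ + 1)) := nil.cons h

/-- A unary number is a list of `nil`s, so recursion is a fold whose index is the length of the
prefix. The body does not receive this index; a state that needs it must carry it. -/
theorem natRec {n : Γ → ℕ} {F : Γ → ℕ → Val} (hn : ∀ γ, n γ ≤ c * (N γ + 1) ^ d)
    (h : Comp N (d + k) env (fun γ => Val.ofNat (n γ)))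
    (h₀ : Comp N (d + k) env (fun γ => F γ 0))
    (hs : Comp (fun p : NCtx n => N p.base) k
      (fun p => Val.cons (env p.base) (F p.base p.i)) (fun p => F p.base (p.i + 1))) :
    Comp N (d + k) env (fun γ => F γ (n γ)) := by
  have := foldl (α := fun _ => Unit) (l := fun γ => List.replicate (n γ) ())
    (enc := fun _ _ => Val.nil) (F := fun γ l => F γ l.length) (by simpa using hn)
    (by simpa [Val.ofNat] using h) h₀
    (((id.hd.cons id.tl.tl).congr (e' := fun p => Val.cons (env p.base) (F p.base p.pre.length))
      (fun _ => rfl) (fun p => rfl)).comp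
      ((hs.reindex (fun p : LCtx (α := fun _ : Γ => Unit) fun γ => List.replicate (n γ) () =>
        (⟨p.base, p.pre.length, by
          have := congrArg List.length p.eq
          simp at this
          omega⟩ : NCtx n))).congr (fun _ => rfl) fun p => by simp))
  simpa using this

theorem natAdd {i j : Γ → ℕ} (hj : ∀ γ, j γ ≤ c * (N γ + 1) ^ d)
    (h₁ : Comp N d env (fun γ => Val.ofNat (i γ))) (h₂ : Comp N d env (fun γ => Val.ofNat (j γ))) :
    Comp N d env (fun γ => Val.ofNat (i γ + j γ)) :=
  natRec (k := 0) (F := fun γ t => Val.ofNat (i γ + t)) hj h₂ h₁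
    ((nil.cons id.tl).congr (fun _ => rfl) fun p => by simp [← add_assoc, Val.ofNat_succ])

theorem drop {l : Γ → List Val} {i : Γ → ℕ} (hi : ∀ γ, i γ ≤ c * (N γ + 1) ^ d)
    (h₁ : Comp N d env (fun γ => Val.ofList (l γ)))
    (h₂ : Comp N d env (fun γ => Val.ofNat (i γ))) :
    Comp N d env (fun γ => Val.ofList ((l γ).drop (i γ))) :=
  natRec (k := 0) (F := fun γ t => Val.ofList ((l γ).drop t)) hi h₂ (by simpa using h₁)
    (id.tl.tl.congr (fun _ => rfl) fun p => by simp [Val.tl_ofList])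

theorem or {b b' : Γ → Bool} (h : Comp N k env (fun γ => Val.ofBool (b γ)))
    (h' : Comp N k env (fun γ => Val.ofBool (b' γ))) :
    Comp N k env (fun γ => Val.ofBool (b γ || b' γ)) :=
  (h.ite (q := fun γ => b γ = true) (fun _ => Val.ofBool_ne_nil) (const (Val.ofBool true)) h').congr
    (fun _ => rfl) fun γ => by cases b γ <;> rfl

theorem bool {q : Γ → Prop} [DecidablePred q] (h : Comp N k env e)
    (hq : ∀ γ, e γ ≠ Val.nil ↔ q γ) : Comp N k env (fun γ => Val.ofBool (decide (q γ))) :=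
  (h.ite hq (const (Val.ofBool true)) nil).congr (fun _ => rfl) fun γ => by
    by_cases hγ : q γ <;> simp [hγ, Val.ofBool]

/-- A list of a fixed number of expressions. -/
theorem ofFn {q : ℕ} {f : Γ → Fin q → Val} (h : ∀ j, Comp N k env (fun γ => f γ j)) :
    Comp N k env (fun γ => Val.ofList (List.ofFn (f γ))) := by
  induction q with
  | zero => simpa using nil
  | succ q ih => simpa [List.ofFn_succ] using (h 0).cons (ih fun j => h j.succ)

end Comp

/-! ### Polynomial time -/

/-- Polynomially bounded functions. -/
def PBound {Γ : Type} (N n : Γ → ℕ) : Prop := ∃ c d : ℕ, ∀ γ, n γ ≤ c * (N γ + 1) ^ d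

/-- Expressions that are computable in polynomial time. -/
def PComp {Γ : Type} (N : Γ → ℕ) (env e : Γ → Val) : Prop := ∃ k, Comp N k env e

/-- Polynomially bounded numbers that are computable in polynomial time. -/
def NComp {Γ : Type} (N : Γ → ℕ) (env : Γ → Val) (n : Γ → ℕ) : Prop :=
  PComp N env (fun γ => Val.ofNat (n γ)) ∧ PBound N n

/-- Lists of polynomially bounded length that are computable in polynomial time. -/
def LComp {Γ : Type} {α : Γ → Type} (N : Γ → ℕ) (env : Γ → Val) (enc : ∀ γ, α γ → Val)
    (l : ∀ γ, List (α γ)) : Prop :=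
  PComp N env (fun γ => Val.ofList ((l γ).map (enc γ))) ∧ PBound N (fun γ => (l γ).length)

section PolynomialTime

variable {Γ Γ' : Type} {N n n' : Γ → ℕ} {env e e₁ e₂ : Γ → Val} {α β : Γ → Type}
  {enc : ∀ γ, α γ → Val} {enc' : ∀ γ, β γ → Val} {l : ∀ γ, List (α γ)}

namespace PBound

theorem mono (h : PBound N n) (hn : ∀ γ, n' γ ≤ n γ) : PBound N n' := by
  obtain ⟨c, d, h⟩ := h
  exact ⟨c, d, fun γ => (hn γ).trans (h γ)⟩

theorem self : PBound N N := ⟨1, 1, fun γ => by simp⟩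

theorem const (c : ℕ) : PBound N (fun _ => c) := ⟨c, 0, fun γ => by simp⟩

theorem add (h : PBound N n) (h' : PBound N n') : PBound N (fun γ => n γ + n' γ) := by
  obtain ⟨c, d, h⟩ := h
  obtain ⟨c', d', h'⟩ := h'
  refine ⟨c + c', d + d', fun γ => ?_⟩
  rw [add_mul]
  refine Nat.add_le_add ((h γ).trans (Nat.mul_le_mul_left _ ?_))
    ((h' γ).trans (Nat.mul_le_mul_left _ ?_)) <;>
  exact Nat.pow_le_pow_right (by omega) (by omega)

theorem reindex (h : PBound N n) (φ : Γ' → Γ) : PBound (fun p => N (φ p)) (fun p => n (φ p)) := by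
  obtain ⟨c, d, h⟩ := h
  exact ⟨c, d, fun p => h (φ p)⟩

end PBound

namespace PComp

theorem reindex (h : PComp N env e) (φ : Γ' → Γ) :
    PComp (fun p => N (φ p)) (fun p => env (φ p)) (fun p => e (φ p)) :=
  h.imp fun _ h => h.reindex φ

theorem congr {env' e' : Γ → Val} (h : PComp N env e) (h1 : ∀ γ, env γ = env' γ)
    (h2 : ∀ γ, e γ = e' γ) : PComp N env' e' := h.imp fun _ h => h.congr h1 h2

theorem change {N' : Γ → ℕ} (h : PComp N env e) (hN : PBound N' N) : PComp N' env e := by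
  obtain ⟨c, d, hN⟩ := hN.add (.const 1)
  exact h.elim fun _ h => ⟨_, h.change hN⟩

theorem id : PComp N env env := ⟨0, .id⟩

theorem const (v : Val) : PComp N env (fun _ => v) := ⟨0, .const v⟩

theorem comp (h₁ : PComp N env e₁) (h₂ : PComp N e₁ e₂) : PComp N env e₂ := by
  obtain ⟨k, h₁⟩ := h₁
  obtain ⟨k', h₂⟩ := h₂
  exact ⟨k + k', (h₁.mono (by omega)).comp (h₂.mono (by omega))⟩

theorem cons (h₁ : PComp N env e₁) (h₂ : PComp N env e₂) :
    PComp N env (fun γ => Val.cons (e₁ γ) (e₂ γ)) := by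
  obtain ⟨k, h₁⟩ := h₁
  obtain ⟨k', h₂⟩ := h₂
  exact ⟨k + k', (h₁.mono (by omega)).cons (h₂.mono (by omega))⟩

theorem hd (h : PComp N env e) : PComp N env (fun γ => (e γ).hd) := h.imp fun _ h => h.hd

theorem tl (h : PComp N env e) : PComp N env (fun γ => (e γ).tl) := h.imp fun _ h => h.tl

theorem ite {q : Γ → Prop} [DecidablePred q] {c : Γ → Val} (hc : PComp N env c)
    (hq : ∀ γ, c γ ≠ Val.nil ↔ q γ) (h₁ : PComp N env e₁) (h₂ : PComp N env e₂) :
    PComp N env (fun γ => if q γ then e₁ γ else e₂ γ) := by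
  obtain ⟨k, hc⟩ := hc
  obtain ⟨k₁, h₁⟩ := h₁
  obtain ⟨k₂, h₂⟩ := h₂
  exact ⟨k + k₁ + k₂, (hc.mono (by omega)).ite hq (h₁.mono (by omega)) (h₂.mono (by omega))⟩

theorem wk (h : PComp N env e) (φ : Γ' → Γ) (r : Γ' → Val) :
    PComp (fun p => N (φ p)) (fun p => Val.cons (env (φ p)) (r p)) (fun p => e (φ p)) :=
  h.imp fun _ h => h.wk φ r

theorem ofFn {q : ℕ} {f : Γ → Fin q → Val} (h : ∀ j, PComp N env (fun γ => f γ j)) :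
    PComp N env (fun γ => Val.ofList (List.ofFn (f γ))) := by
  choose k h using h
  exact ⟨∑ j, k j, .ofFn fun j => (h j).mono
    (Finset.single_le_sum (f := k) (fun _ _ => Nat.zero_le _) (Finset.mem_univ j))⟩

theorem foldl {F : ∀ γ, List (α γ) → Val} (hl : LComp N env enc l)
    (h₀ : PComp N env (fun γ => F γ []))
    (h : PComp (fun p : LCtx l => N p.base)
      (fun p => Val.cons (env p.base) (Val.cons (enc _ p.x) (F _ p.pre)))
      (fun p => F _ (p.pre ++ [p.x]))) :
    PComp N env (fun γ => F γ (l γ)) := by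
  obtain ⟨⟨k₁, hl⟩, c, d, hlen⟩ := hl
  obtain ⟨k₂, h₀⟩ := h₀
  obtain ⟨k₃, h⟩ := h
  exact ⟨_, Comp.foldl (k := k₁ + k₂ + k₃) hlen (hl.mono (by omega)) (h₀.mono (by omega))
    (h.mono (by omega))⟩

theorem foldr {F : ∀ γ, List (α γ) → Val} (hl : LComp N env enc l)
    (h₀ : PComp N env (fun γ => F γ []))
    (h : PComp (fun p : LCtx l => N p.base)
      (fun p => Val.cons (env p.base) (Val.cons (enc _ p.x) (F _ p.post)))
      (fun p => F _ (p.x :: p.post))) :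
    PComp N env (fun γ => F γ (l γ)) := by
  obtain ⟨⟨k₁, hl⟩, c, d, hlen⟩ := hl
  obtain ⟨k₂, h₀⟩ := h₀
  obtain ⟨k₃, h⟩ := h
  exact ⟨_, Comp.foldr (k := k₁ + k₂ + k₃) hlen (hl.mono (by omega)) (h₀.mono (by omega))
    (h.mono (by omega))⟩

theorem natRec {F : Γ → ℕ → Val} (hn : NComp N env n) (h₀ : PComp N env (fun γ => F γ 0))
    (h : PComp (fun p : NCtx n => N p.base)
      (fun p => Val.cons (env p.base) (F p.base p.i)) (fun p => F p.base (p.i + 1))) :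
    PComp N env (fun γ => F γ (n γ)) := by
  obtain ⟨⟨k₁, hl⟩, c, d, hlen⟩ := hn
  obtain ⟨k₂, h₀⟩ := h₀
  obtain ⟨k₃, h⟩ := h
  exact ⟨_, Comp.natRec (k := k₁ + k₂ + k₃) hlen (hl.mono (by omega)) (h₀.mono (by omega))
    (h.mono (by omega))⟩

/-- An entry of a list that is given by a function. -/
theorem get {f : ∀ γ, Fin (n γ) → Val} {i : ∀ γ, Fin (n γ)} (hn : PBound N n)
    (h : PComp N env (fun γ => Val.ofList (List.ofFn (f γ))))
    (hi : PComp N env (fun γ => Val.ofNat (i γ))) : PComp N env (fun γ => f γ (i γ)) := by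
  have hb : PBound N (fun γ => (i γ : ℕ)) := hn.mono fun γ => (i γ).2.le
  obtain ⟨c, d, hb⟩ := hb
  obtain ⟨k₁, h⟩ := h
  obtain ⟨k₂, hi⟩ := hi
  refine ⟨_, (Comp.drop (c := c) (d := d + k₁ + k₂) (fun γ => (hb γ).trans
    (Nat.mul_le_mul_left _ (Nat.pow_le_pow_right (by omega) (by omega))))
    (h.mono (by omega)) (hi.mono (by omega))).hd.congr (fun _ => rfl) fun γ => ?_⟩
  rw [List.drop_eq_getElem_cons (by simp)]
  simp

theorem map {f : ∀ γ, α γ → β γ} (hl : LComp N env enc l)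
    (h : PComp (fun p : LCtx l => N p.base) (fun p => Val.cons (env p.base) (enc _ p.x))
      (fun p => enc' _ (f _ p.x))) :
    PComp N env (fun γ => Val.ofList (((l γ).map (f γ)).map (enc' γ))) :=
  foldr (F := fun γ l => Val.ofList ((l.map (f γ)).map (enc' γ))) hl (const _)
    ((((id.hd.cons id.tl.hd).comp h).cons id.tl.tl).congr (fun _ => rfl) fun _ => rfl)

end PComp

namespace NComp

theorem wk (h : NComp N env n) (φ : Γ' → Γ) (r : Γ' → Val) :
    NComp (fun p => N (φ p)) (fun p => Val.cons (env (φ p)) (r p)) (fun p => n (φ p)) :=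
  ⟨h.1.wk φ r, h.2.reindex φ⟩

theorem natSub (h : NComp N env n) (h' : NComp N env n') :
    NComp N env (fun γ => n γ - n' γ) := by
  refine ⟨PComp.natRec (F := fun γ t => Val.ofNat (n γ - t)) h' h.1
    (PComp.id.tl.tl.congr (fun _ => rfl) fun p => by simp [Nat.sub_add_eq]),
    h.2.mono fun γ => Nat.sub_le _ _⟩

/-- Two numbers are equal when both truncated differences vanish. -/
theorem eq (h : NComp N env n) (h' : NComp N env n') :
    PComp N env (fun γ => Val.ofBool (decide (n γ = n' γ))) :=
  ((h.natSub h').1.ite (fun _ => Val.ofNat_ne_nil) (.const (Val.ofBool false))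
    ((h'.natSub h).1.ite (fun _ => Val.ofNat_ne_nil) (.const (Val.ofBool false))
      (.const (Val.ofBool true)))).congr (fun _ => rfl) fun γ => by
        dsimp only
        split_ifs with h1 h2
        · rw [decide_eq_false (by omega)]
        · rw [decide_eq_false (by omega)]
        · rw [decide_eq_true (by omega)]

/-- Division by a positive constant. -/
theorem divConst (h : NComp N env n) (c : ℕ) (hc : 0 < c) : NComp N env (fun γ => n γ / c) := by
  refine ⟨?_, h.2.mono fun γ => Nat.div_le_self _ _⟩
  -- Subtraction of a constant needs no loop: it is a fixed number of `tl` operations.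
  have key : ∀ m : ℕ, ∀ {Γ : Type} {N : Γ → ℕ} {env : Γ → Val} {n : Γ → ℕ},
      PComp N env (fun γ => Val.ofNat (n γ)) → PComp N env (fun γ => Val.ofNat (n γ - m)) := by
    intro m
    induction m with
    | zero => intro Γ N env n h; exact h
    | succ m ih => intro Γ N env n h; simpa [Nat.sub_add_eq] using (ih h).tl
  -- The state after `t` rounds is the remainder and the quotient so far. Running `n γ` rounds
  -- suffices, since the quotient stops growing at `n γ / c`.
  have h1 : PComp N env (fun γ => Val.cons (Val.ofNat (n γ - n γ * c))
      (Val.ofNat (min (n γ) (n γ / c)))) := by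
    refine PComp.natRec (F := fun γ t => Val.cons (Val.ofNat (n γ - t * c))
      (Val.ofNat (min t (n γ / c)))) h ((h.1.cons (.const .nil)).congr (fun _ => rfl)
        fun γ => by simp) ?_
    have hrem : PComp (fun p : NCtx n => N p.base) (fun p => Val.cons (env p.base)
        (Val.cons (Val.ofNat (n p.base - p.i * c)) (Val.ofNat (min p.i (n p.base / c)))))
        (fun p => Val.ofNat (n p.base - p.i * c)) := PComp.id.tl.hd
    have hq : PComp (fun p : NCtx n => N p.base) (fun p => Val.cons (env p.base)
        (Val.cons (Val.ofNat (n p.base - p.i * c)) (Val.ofNat (min p.i (n p.base / c)))))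
        (fun p => Val.ofNat (min p.i (n p.base / c))) := PComp.id.tl.tl
    refine ((key c hrem).cons ((key (c - 1) hrem).ite (fun _ => Val.ofNat_ne_nil)
      ((PComp.const .nil).cons hq) hq)).congr (fun _ => rfl) fun p => ?_
    have h2 : n p.base - (p.i + 1) * c = n p.base - p.i * c - c := by
      rw [add_mul, one_mul, Nat.sub_add_eq]
    -- The test whether another `c` fits into the remainder, phrased as a comparison with `nil`.
    have h3 : (n p.base - p.i * c - (c - 1) ≠ 0) ↔ p.i + 1 ≤ n p.base / c := by
      rw [Nat.le_div_iff_mul_le hc, add_mul, one_mul]; omega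
    rw [h2]
    congr 1
    split_ifs with h4
    · rw [h3] at h4
      rw [min_eq_left (by omega), min_eq_left h4, Val.ofNat_succ]
    · rw [h3] at h4
      rw [min_eq_right (by omega), min_eq_right (by omega)]
  refine h1.tl.congr (fun _ => rfl) fun γ => ?_
  simp [Nat.div_le_self]

end NComp

namespace LComp

theorem wk (h : LComp N env enc l) (φ : Γ' → Γ) (r : Γ' → Val) :
    LComp (α := fun p => α (φ p)) (fun p => N (φ p)) (fun p => Val.cons (env (φ p)) (r p))
      (fun p => enc (φ p)) (fun p => l (φ p)) :=
  ⟨h.1.wk φ r, h.2.reindex φ⟩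

theorem length (h : LComp N env enc l) : NComp N env (fun γ => (l γ).length) :=
  ⟨PComp.foldl (F := fun γ l => Val.ofNat l.length) h (.const _)
    (((PComp.const .nil).cons PComp.id.tl.tl).congr (fun _ => rfl) fun p => by
      simp [Val.ofNat_succ]), h.2⟩

theorem filter {b : ∀ γ, α γ → Bool} (hl : LComp N env enc l)
    (h : PComp (fun p : LCtx l => N p.base) (fun p => Val.cons (env p.base) (enc _ p.x))
      (fun p => Val.ofBool (b _ p.x))) :
    LComp N env enc (fun γ => (l γ).filter (b γ)) :=
  ⟨PComp.foldr (F := fun γ l => Val.ofList ((l.filter (b γ)).map (enc γ))) hl (.const _)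
    ((((PComp.id.hd.cons PComp.id.tl.hd).comp h).ite (fun _ => Val.ofBool_ne_nil)
      (PComp.id.tl.hd.cons PComp.id.tl.tl) PComp.id.tl.tl).congr (fun _ => rfl) fun p => by
        by_cases hb : b _ p.x <;> simp [hb]),
    hl.2.mono fun γ => List.length_filter_le _ _⟩

theorem finRange (h : NComp N env n) :
    LComp (α := fun γ => Fin (n γ)) N env (fun _ i => Val.ofNat i)
      (fun γ => List.finRange (n γ)) := by
  -- The state carries the counter next to the list. Consing yields the numbers in descending order,
  -- hence the reversal afterwards.
  have h1 : PComp N env (fun γ => Val.cons (Val.ofNat (n γ))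
      (Val.ofList ((List.range (n γ)).reverse.map Val.ofNat))) :=
    PComp.natRec (F := fun γ t => Val.cons (Val.ofNat t)
      (Val.ofList ((List.range t).reverse.map Val.ofNat))) h (.const _)
      ((((PComp.const .nil).cons PComp.id.tl.hd).cons PComp.id.tl).congr (fun _ => rfl)
        fun p => by simp [List.range_succ, Val.ofNat_succ])
  obtain ⟨k, h1⟩ := h1.tl
  obtain ⟨c, d, hb⟩ := h.2
  refine ⟨⟨d + k, ?_⟩, by simpa using h.2⟩
  refine (Comp.reverse (α := fun _ => ℕ) (c := c) (by simpa using hb)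
    (h1.mono (by omega))).congr (fun _ => rfl) fun γ => ?_
  rw [List.reverse_reverse, ← List.map_coe_finRange_eq_range, List.map_map]
  rfl

theorem idxOf [∀ γ, DecidableEq (α γ)] {x : ∀ γ, α γ} (hl : LComp N env enc l)
    (h : PComp (fun p : LCtx l => N p.base) (fun p => Val.cons (env p.base) (enc _ p.x))
      (fun p => Val.ofBool (decide (p.x = x p.base)))) :
    NComp N env (fun γ => (l γ).idxOf (x γ)) :=
  ⟨PComp.foldr (F := fun γ l => Val.ofNat (l.idxOf (x γ))) hl (.const _)
    ((((PComp.id.hd.cons PComp.id.tl.hd).comp h).ite (fun _ => Val.ofBool_ne_nil)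
      (.const .nil) ((PComp.const .nil).cons PComp.id.tl.tl)).congr (fun _ => rfl) fun p => by
        by_cases hb : p.x = x p.base
        · simp [hb]
        · simp [hb, List.idxOf_cons_ne, Val.ofNat_succ]),
    hl.2.mono fun γ => List.idxOf_le_length⟩

end LComp

/-- A list that is given by a function. -/
theorem PComp.tabulate {f : ∀ γ, Fin (n γ) → Val} (hn : NComp N env n)
    (h : PComp (fun p : LCtx fun γ => List.finRange (n γ) => N p.base)
      (fun p => Val.cons (env p.base) (Val.ofNat p.x)) (fun p => f _ p.x)) :
    PComp N env (fun γ => Val.ofList (List.ofFn (f γ))) :=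
  (PComp.map (β := fun _ => Val) (enc' := fun _ v => v) (f := f) (LComp.finRange hn) h).congr
    (fun _ => rfl) fun γ => by simp [List.ofFn_eq_map, Function.comp_def]

end PolynomialTime

/-! ### Covering projections -/

namespace DartGraph

variable {V D V' D' : Type*} {G : DartGraph V D} {H : DartGraph V' D'} {fV : V → V'} {fD : D → D'}

theorem IsCoveringProjection.vert (h : G.IsCoveringProjection H fV fD) (d : D) :
    H.vert (fD d) = fV (G.vert d) := (h.2.1 (G.vert d)).mapsTo rfl

/-- The image of a link is a pair `{e, H.inv e}`, and in either matching of the two pairs the images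
of `d` and `G.inv d` are partners. -/
theorem IsCoveringProjection.inv (h : G.IsCoveringProjection H fV fD) (d : D) :
    fD (G.inv d) = H.inv (fD d) := by
  obtain ⟨e, he⟩ := h.2.2 {d, G.inv d} ⟨d, rfl⟩
  rw [Set.image_pair, Set.pair_eq_pair_iff] at he
  rcases he with ⟨h1, h2⟩ | ⟨h1, h2⟩
  · rw [← h1, h2]
  · rw [← h1, ← h2, H.inv_inv]

/-- Local bijectivity puts exactly one dart over `d` at each vertex over `H.vert d`, so `G.vert` is
a bijection between the two fibres. -/
theorem IsCoveringProjection.ncard_dart_fiber (h : G.IsCoveringProjection H fV fD) (d : D') :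
    (fD ⁻¹' {d}).ncard = (fV ⁻¹' {H.vert d}).ncard := by
  have himg : G.vert '' (fD ⁻¹' {d}) = fV ⁻¹' {H.vert d} := by
    ext u
    constructor
    · rintro ⟨x, rfl, rfl⟩
      exact (h.vert x).symm
    · intro hu
      obtain ⟨x, hx, hxd⟩ := (h.2.1 u).surjOn (show d ∈ H.darts (fV u) from hu.symm)
      exact ⟨x, hxd, hx⟩
  rw [← himg, Set.InjOn.ncard_image]
  intro x hx y hy hxy
  exact (h.2.1 (G.vert x)).injOn rfl hxy.symm (hx.trans hy.symm)

/-- The involution of `G` carries the fibre of `d` onto that of `H.inv d`. -/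
theorem IsCoveringProjection.ncard_fiber_inv (h : G.IsCoveringProjection H fV fD) (d : D') :
    (fV ⁻¹' {H.vert d}).ncard = (fV ⁻¹' {H.vert (H.inv d)}).ncard := by
  rw [← h.ncard_dart_fiber, ← h.ncard_dart_fiber]
  have himg : G.inv '' (fD ⁻¹' {d}) = fD ⁻¹' {H.inv d} := by
    ext x
    constructor
    · rintro ⟨x, rfl, rfl⟩
      exact h.inv x
    · intro hx
      exact ⟨G.inv x, by rw [Set.mem_preimage, h.inv, show fD x = _ from hx, H.inv_inv]; rfl,
        G.inv_inv x⟩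
  rw [← himg, Set.ncard_image_of_injective]
  exact Function.LeftInverse.injective G.inv_inv

theorem IsCoveringProjection.ncard_fiber_eq (h : G.IsCoveringProjection H fV fD)
    {u v : V'} (huv : H.adjGraph.Reachable u v) : (fV ⁻¹' {u}).ncard = (fV ⁻¹' {v}).ncard := by
  obtain ⟨w⟩ := huv
  induction w with
  | nil => rfl
  | cons hadj _ ih =>
    obtain ⟨_, d, rfl, rfl⟩ := hadj
    rw [h.ncard_fiber_inv, ih]

/-- The fibres partition `V` and, by connectedness, have equal size. -/
theorem IsCoveringProjection.ncard_fiber_mul [Finite V] [Finite V']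
    (h : G.IsCoveringProjection H fV fD) (hH : H.adjGraph.Preconnected) (u : V') :
    (fV ⁻¹' {u}).ncard * Nat.card V' = Nat.card V := by
  have := Fintype.ofFinite V'
  have key : ∀ v, Nat.card {x // fV x = v} = (fV ⁻¹' {u}).ncard := fun v =>
    (Nat.card_coe_set_eq (fV ⁻¹' {v})).trans (h.ncard_fiber_eq (hH v u))
  rw [← Nat.card_congr (Equiv.sigmaFiberEquiv fV), Nat.card_sigma,
    Finset.sum_congr rfl fun v _ => key v]
  simp [mul_comm]

theorem adjGraph_component (G : DartGraph V D) (c : G.Component) :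
    (G.component c).adjGraph = c.toSimpleGraph := by
  ext u v
  constructor
  · rintro ⟨hne, d, rfl, rfl⟩
    exact ⟨fun h => hne (Subtype.ext h), d.1, rfl, rfl⟩
  · rintro ⟨hne, d, hu, hv⟩
    have hd : d ∈ G.compDarts c := by
      have := u.2
      rw [← (show G.vert d = u from hu)] at this
      exact this
    exact ⟨fun h => hne (congrArg Subtype.val h), ⟨d, hd⟩, Subtype.ext hu, Subtype.ext hv⟩

theorem preconnected_component (G : DartGraph V D) (c : G.Component) :
    (G.component c).adjGraph.Preconnected := by
  rw [adjGraph_component]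
  exact c.connected_toSimpleGraph.preconnected

theorem card_supp_pos [Finite V] (c : G.Component) : 0 < Nat.card c.supp := by
  have : Nonempty c.supp := c.nonempty_supp.to_subtype
  exact Nat.card_pos

/-- The natural-number quotient in `covPattern` is exact, being the common fibre size. -/
theorem IsCoveringProjection.ncard_component_fiber [Finite V] [Finite V'] {c : G.Component}
    {c' : H.Component} {fV : c.supp → c'.supp} {fD : G.compDarts c → H.compDarts c'}
    (h : (G.component c).IsCoveringProjection (H.component c') fV fD) (u : c'.supp) :
    (fV ⁻¹' {u}).ncard = G.covPattern H c c' := by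
  rw [covPattern, if_pos ⟨fV, fD, h⟩, ← h.ncard_fiber_mul (H.preconnected_component c') u,
    Nat.mul_div_cancel _ (card_supp_pos c')]

/-- The value `0` encodes non-edges faithfully: a covering with empty fibres would make the nonempty
component `c` empty. -/
theorem covPattern_ne_zero [Finite V] [Finite V'] {c : G.Component} {c' : H.Component} :
    G.covPattern H c c' ≠ 0 ↔ (G.component c).Covers (H.component c') := by
  refine ⟨fun h => ?_, fun h => ?_⟩
  · by_contra hn
    exact h (if_neg hn)
  · rintro h0
    obtain ⟨fV, fD, hf⟩ := h
    obtain ⟨u⟩ : Nonempty c'.supp := c'.nonempty_supp.to_subtype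
    have := hf.ncard_fiber_mul (H.preconnected_component c') u
    rw [hf.ncard_component_fiber, h0, zero_mul] at this
    exact (card_supp_pos c).ne this

theorem covPattern_le (c : G.Component) (c' : H.Component) :
    G.covPattern H c c' ≤ Nat.card c.supp := by
  rw [covPattern]
  split_ifs
  · exact Nat.div_le_self _ _
  · exact Nat.zero_le _

/-- The fibre of `u` splits along the components of `G`. Those sent to the component of `u`
contribute their weight, the others nothing. -/
theorem ncard_preimage_eq_sum [Finite V] [Finite V'] {ψ : G.Component → H.Component}
    (hV : ∀ c : G.Component, Set.MapsTo fV c.supp (ψ c).supp)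
    (hD : ∀ c, Set.MapsTo fD (G.compDarts c) (H.compDarts (ψ c)))
    (hc : ∀ c, (G.component c).IsCoveringProjection (H.component (ψ c)) (hV c).restrict
      (hD c).restrict) {p q : ℕ} (g : Fin p ≃ G.Component) (h : Fin q ≃ H.Component)
    {φ : Fin p → Fin q} (hφ : ∀ i, h (φ i) = ψ (g i)) {u : V'} {j : Fin q}
    (hj : H.adjGraph.connectedComponentMk u = h j) :
    (fV ⁻¹' {u}).ncard = ∑ i with φ i = j, G.covPattern H (g i) (h j) := by
  classical
  have := Fintype.ofFinite V
  rw [Set.ncard_eq_toFinset_card', Finset.card_eq_sum_card_fiberwise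
    (f := fun x => g.symm (G.adjGraph.connectedComponentMk x)) (t := Finset.univ) (by simp),
    Finset.sum_filter]
  refine Finset.sum_congr rfl fun i _ => ?_
  split_ifs with hi
  · have hψ : ψ (g i) = h j := by rw [← hφ, hi]
    have hu : u ∈ (ψ (g i)).supp := by rw [hψ]; exact hj
    rw [← hψ, ← (hc (g i)).ncard_component_fiber ⟨u, hu⟩,
      ← Set.ncard_image_of_injective _ Subtype.val_injective, ← Set.ncard_coe_finset]
    congr 1
    ext x
    simp only [Set.mem_toFinset, Finset.coe_filter, Set.mem_preimage,
      Set.mem_singleton_iff, Set.mem_ofPred_eq, Set.mem_image, Subtype.exists, exists_and_right,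
      exists_eq_right, Equiv.symm_apply_eq]
    constructor
    · rintro ⟨h1, h2⟩
      exact ⟨h2, Subtype.ext h1⟩
    · rintro ⟨h1, h2⟩
      exact ⟨congrArg Subtype.val h2, h1⟩
  · rw [Finset.card_eq_zero, Finset.filter_eq_empty_iff]
    rintro x hx hxi
    rw [Equiv.symm_apply_eq] at hxi
    have h1 := hV (g i) hxi
    rw [Set.mem_toFinset] at hx
    rw [show fV x = u from hx, ← hφ] at h1
    exact hi (h.injective ((show H.adjGraph.connectedComponentMk u = _ from h1).symm.trans hj))

/-- Equitable covers in terms of the covering pattern. -/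
theorem equitablyCovers_iff [Finite V] [Finite V'] {p q : ℕ} (g : Fin p ≃ G.Component)
    (h : Fin q ≃ H.Component) : G.EquitablyCovers H ↔ ∃ (φ : Fin p → Fin q) (k : ℕ),
      (∀ i, G.covPattern H (g i) (h (φ i)) ≠ 0) ∧
      ∀ j, ∑ i with φ i = j, G.covPattern H (g i) (h j) = k := by
  constructor
  · rintro ⟨fV, fD, hc, heq⟩
    choose ψ hV hD hcov using hc
    refine ⟨fun i => h.symm (ψ (g i)), ?_⟩
    have key := fun (u : V') (j : Fin q) => ncard_preimage_eq_sum (u := u) (j := j)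
      (φ := fun i => h.symm (ψ (g i))) hV hD hcov g h (by simp)
    have h1 : ∀ i, G.covPattern H (g i) (h (h.symm (ψ (g i)))) ≠ 0 := fun i => by
      rw [h.apply_symm_apply, covPattern_ne_zero]
      exact ⟨_, _, hcov (g i)⟩
    rcases isEmpty_or_nonempty V' with hE | ⟨⟨u₀⟩⟩
    -- Without vertices `H` has no components, so there is no column condition and any `k` would do.
    · exact ⟨0, h1, fun j => ((h j).nonempty_supp.some : V') |> hE.elim⟩
    · refine ⟨(fV ⁻¹' {u₀}).ncard, h1, fun j => ?_⟩
      obtain ⟨u, hu⟩ := (h j).nonempty_supp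
      rw [← key u j hu]
      exact heq _ _
  · rintro ⟨φ, k, h1, h2⟩
    let ψ : G.Component → H.Component := fun c => h (φ (g.symm c))
    have hψ : ∀ c, (G.component c).Covers (H.component (ψ c)) := fun c => by
      have := h1 (g.symm c)
      rwa [g.apply_symm_apply, covPattern_ne_zero] at this
    choose fV fD hf using hψ
    -- Gluing: every vertex and dart uses the projection chosen for its own component.
    let FV : V → V' := fun v => (fV (G.adjGraph.connectedComponentMk v) ⟨v, rfl⟩ : V')
    let FD : D → D' := fun d =>
      (fD (G.adjGraph.connectedComponentMk (G.vert d)) ⟨d, rfl⟩ : D')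
    have hFV : ∀ (c) (x : c.supp), FV x = fV c x := by
      rintro c ⟨x, rfl⟩; rfl
    have hFD : ∀ (c) (x : G.compDarts c), FD x = fD c x := by
      rintro c ⟨x, rfl⟩; rfl
    have hV : ∀ c : G.Component, Set.MapsTo FV c.supp (ψ c).supp := fun c x hx => by
      rw [hFV c ⟨x, hx⟩]; exact (fV c ⟨x, hx⟩).2
    have hD : ∀ c : G.Component, Set.MapsTo FD (G.compDarts c) (H.compDarts (ψ c)) :=
      fun c x hx => by rw [hFD c ⟨x, hx⟩]; exact (fD c ⟨x, hx⟩).2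
    have hcov : ∀ c, (G.component c).IsCoveringProjection (H.component (ψ c)) (hV c).restrict
        (hD c).restrict := fun c => by
      have e1 : (hV c).restrict = fV c := funext fun x => Subtype.ext (hFV c x)
      have e2 : (hD c).restrict = fD c := funext fun x => Subtype.ext (hFD c x)
      rw [e1, e2]
      exact hf c
    have key : ∀ u, (FV ⁻¹' {u}).ncard = k := fun u => by
      rw [ncard_preimage_eq_sum hV hD hcov g h (φ := φ) (by simp [ψ])
        (j := h.symm (H.adjGraph.connectedComponentMk u)) (by simp), h2]
    exact ⟨FV, FD, fun c => ⟨ψ c, hV c, hD c, hcov c⟩, fun u v => by rw [key, key]⟩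

/-! ### Isomorphism invariance of covering. -/

theorem Covers.of_equiv {V₁ D₁ : Type*} {G₁ : DartGraph V₁ D₁} (h : G.Covers H) (eV : V₁ ≃ V)
    (eD : D₁ ≃ D) (hv : ∀ d, eV (G₁.vert d) = G.vert (eD d))
    (hi : ∀ d, eD (G₁.inv d) = G.inv (eD d)) : G₁.Covers H := by
  obtain ⟨fV, fD, h1, h2, h3⟩ := h
  refine ⟨fV ∘ eV, fD ∘ eD, h1.comp eD.surjective, fun u => ?_, ?_⟩
  · refine (h2 (eV u)).comp ⟨fun d hd => ?_, eD.injective.injOn, fun d hd => ?_⟩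
    · rw [darts, Set.mem_ofPred_eq, ← hv, show G₁.vert d = u from hd]
    · refine ⟨eD.symm d, eV.injective ?_, by simp⟩
      rw [hv, eD.apply_symm_apply]
      exact hd
  · rintro _ ⟨d, rfl⟩
    rw [Set.image_comp, Set.image_pair, hi]
    exact h3 _ ⟨_, rfl⟩

/-- Covering is invariant under isomorphism of the covering graph. -/
theorem covers_congr {V₁ D₁ : Type*} {G₁ : DartGraph V₁ D₁} (eV : V₁ ≃ V) (eD : D₁ ≃ D)
    (hv : ∀ d, eV (G₁.vert d) = G.vert (eD d)) (hi : ∀ d, eD (G₁.inv d) = G.inv (eD d)) :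
    G₁.Covers H ↔ G.Covers H := by
  refine ⟨fun h => h.of_equiv eV.symm eD.symm (fun d => ?_) (fun d => ?_),
    fun h => h.of_equiv eV eD hv hi⟩
  · rw [Equiv.symm_apply_eq, hv, eD.apply_symm_apply]
  · rw [Equiv.symm_apply_eq, hi, eD.apply_symm_apply]

end DartGraph

/-! ### Programs and computable expressions -/

/-- `T.eval 1` is the sum of the coefficients, and each power of `n` is at most the top power of `n
+ 1`. -/
theorem Polynomial.eval_le_mul_pow (T : Polynomial ℕ) (n : ℕ) :
    T.eval n ≤ T.eval 1 * (n + 1) ^ T.natDegree := by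
  rw [Polynomial.eval_eq_sum_range, Polynomial.eval_eq_sum_range, Finset.sum_mul]
  refine Finset.sum_le_sum fun i hi => ?_
  rw [one_pow, mul_one]
  refine Nat.mul_le_mul_left _ ((Nat.pow_le_pow_left (Nat.le_succ n) i).trans ?_)
  exact Nat.pow_le_pow_right (by omega) (by rw [Finset.mem_range] at hi; omega)

/-- Imports a program that expects a cleared store: its variables are cleared first, and
`Exec.transfer` shows that the contents of all others are irrelevant. -/
theorem Comp.of_exec {Γ : Type} {N : Γ → ℕ} {k C : ℕ} {env e : Γ → Val} (P : Prog)
    (h : ∀ γ, ∃ t s, Exec P (Store.single (env γ)) t s ∧ t ≤ C * (N γ + 1) ^ k ∧ s 0 = e γ) :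
    Comp N k env e := by
  refine ⟨.seq (.clear P.bound) P, P.bound + 1, C + P.bound + 2, fun γ s hs => ?_⟩
  obtain ⟨s₁, r₁, h0, h1, h2⟩ := Prog.runs_clear P.bound s
  obtain ⟨t, s₂, e₂, ht, h3⟩ := h γ
  obtain ⟨s₃, e₃, h4, h5⟩ := e₂.transfer (m := P.bound + 1) (u := s₁) (by omega) fun x hx => by
    rcases Nat.eq_zero_or_pos x with rfl | hx0
    · simp [Store.single, h0, hs]
    · rw [h1 x hx0 (by omega), Store.single, Function.update_of_ne (by omega)]
  refine ⟨s₃, (r₁.seq ⟨t, le_rfl, e₃⟩).mono ?_, by rw [h4 0 (by omega), h3], fun x hx => ?_⟩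
  · have := Comp.one_le_pow' (N γ) k
    nlinarith
  · rw [h5 x hx, h2 x (by omega)]

/-- The scratch variables are cleared at the end, so that the output store is a legitimate input
store for a second program. -/
theorem Comp.exists_outputsWithin {Γ : Type} {N : Γ → ℕ} {k : ℕ} {env e : Γ → Val}
    (h : Comp N k env e) :
    ∃ (P : Prog) (C : ℕ), ∀ γ, P.OutputsWithin (env γ) (e γ) (C * (N γ + 1) ^ k) := by
  obtain ⟨P, m, C, hP⟩ := h
  refine ⟨.seq P (.clear m), C + m + 2, fun γ => ?_⟩
  obtain ⟨s₁, r₁, h1, h2⟩ := hP γ (Store.single (env γ)) (by simp [Store.single])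
  obtain ⟨s₂, r₂, h3, h4, h5⟩ := Prog.runs_clear m s₁
  have hs : s₂ = Store.single (e γ) := by
    funext x
    rcases Nat.eq_zero_or_pos x with rfl | hx0
    · simp [Store.single, h3, h1]
    · rw [Store.single, Function.update_of_ne (by omega)]
      rcases le_or_gt x m with hx | hx
      · exact h4 x hx0 hx
      · rw [h5 x hx, h2 x hx.le, Store.single, Function.update_of_ne (by omega)]
  obtain ⟨t, ht, ex⟩ := r₁.seq r₂
  refine ⟨t, hs ▸ ex, ht.trans ?_⟩
  have := Comp.one_le_pow' (N γ) k
  nlinarith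

theorem Comp.exists_answersWithin {Γ : Type} {N : Γ → ℕ} {k : ℕ} {env e : Γ → Val}
    {A : Γ → Prop} (h : Comp N k env e) (hA : ∀ γ, e γ ≠ Val.nil ↔ A γ) :
    ∃ (P : Prog) (C : ℕ), ∀ γ, P.AnswersWithin (env γ) (A γ) (C * (N γ + 1) ^ k) := by
  obtain ⟨P, m, C, hP⟩ := h
  refine ⟨P, C, fun γ => ?_⟩
  obtain ⟨s₁, ⟨t, ht, ex⟩, h1, -⟩ := hP γ (Store.single (env γ)) (by simp [Store.single])
  exact ⟨t, s₁, ex, ht, by rw [h1, hA]⟩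

/-! ### Graphs as contexts -/

/-- An input graph. -/
structure GCtx where
  a : ℕ
  b : ℕ
  G : DartGraph (Fin a) (Fin b)

/-- The size of an input graph. -/
noncomputable def GCtx.size (γ : GCtx) : ℕ := γ.G.size

/-- The encoding of an input graph. -/
def GCtx.env (γ : GCtx) : Val := Val.ofGraph γ.G

open Classical in
-- A solver may answer yes with any tree other than `nil`; `bool` normalises this to a truth value.
theorem Prog.SolvesInPolyTime.pcomp {P : Prog} {A : GraphProblem} (h : P.SolvesInPolyTime A) :
    PComp GCtx.size GCtx.env (fun γ => Val.ofBool (decide (A γ.G))) := by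
  obtain ⟨T, h⟩ := h
  choose t s h1 h2 h3 using h
  exact ⟨T.natDegree, (Comp.of_exec (N := GCtx.size) (env := GCtx.env) (C := T.eval 1)
    (e := fun γ => s γ.G 0) P fun γ => ⟨_, _, h1 γ.G,
      (h2 γ.G).trans (T.eval_le_mul_pow _), rfl⟩).bool fun γ => h3 γ.G⟩

namespace DartGraph

section
variable {V D : Type*} (G : DartGraph V D)

/-- A link arises from at most two darts. The encoding lists darts while the size counts links, so
this makes the number of darts linear in the size. -/
theorem card_darts_le [Finite D] : Nat.card D ≤ 2 * G.links.ncard := by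
  classical
  have := Fintype.ofFinite D
  have h := Finset.card_le_mul_card_image (f := fun d => ({d, G.inv d} : Set D)) Finset.univ 2 ?_
  · rw [Nat.card_eq_fintype_card, links, ← Set.image_univ, ← Finset.coe_univ,
      ← Finset.coe_image, Set.ncard_coe_finset]
    exact h
  · intro e he
    obtain ⟨d, -, rfl⟩ := Finset.mem_image.1 he
    refine (Finset.card_le_card (t := {d, G.inv d}) fun x hx => ?_).trans Finset.card_le_two
    have h1 : x ∈ ({d, G.inv d} : Set D) := (Finset.mem_filter.1 hx).2 ▸ Set.mem_insert _ _
    simpa using h1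

theorem size_le [Finite D] : G.size ≤ Nat.card V + Nat.card D := by
  rw [size, links, ← Set.image_univ, ← Set.ncard_univ D]
  exact Nat.add_le_add_left Set.ncard_image_le _

/-! ### Connected components by merging labels. -/

variable [DecidableEq V]

/-- Merge the label classes of the two ends of the link of `d`. -/
def mergeLabels (L : V → V) (d : D) (z : V) : V :=
  if L z = L (G.vert d) then L (G.vert (G.inv d)) else L z

/-- Labels of the vertices after some darts have been processed. -/
def labels (l : List D) : V → V := l.foldl G.mergeLabels id

theorem labels_append (l : List D) (d : D) :
    G.labels (l ++ [d]) = G.mergeLabels (G.labels l) d := by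
  simp [labels]

/-- Labels are representatives of their classes: a merge redirects one class to the label of
another, which keeps itself as label. The fixed points thus give one root per class. -/
theorem labels_idem (l : List D) (v : V) : G.labels l (G.labels l v) = G.labels l v := by
  induction l using List.reverseRecOn generalizing v with
  | nil => rfl
  | append_singleton l d ih =>
    rw [labels_append]
    unfold mergeLabels
    split_ifs with h1 h2 h3
    · rfl
    · exact ih _
    · rw [ih] at h3; exact absurd h3 h1
    · exact ih _

/-- A merge identifies only the classes of the two ends of one link. -/
theorem reachable_of_labels_eq (l : List D) {u v : V} (h : G.labels l u = G.labels l v) :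
    G.adjGraph.Reachable u v := by
  induction l using List.reverseRecOn generalizing u v with
  | nil => exact (show u = v from h) ▸ .refl _
  | append_singleton l d ih =>
    have hd : G.adjGraph.Reachable (G.vert d) (G.vert (G.inv d)) := by
      by_cases hd : G.vert d = G.vert (G.inv d)
      · rw [hd]
      · exact SimpleGraph.Adj.reachable ⟨hd, d, rfl, rfl⟩
    rw [labels_append] at h
    unfold mergeLabels at h
    split_ifs at h with h1 h2 h2
    · exact (ih h1).trans (ih h2).symm
    · exact (ih h1).trans (hd.trans (ih h))
    · exact (ih h).trans (hd.symm.trans (ih h2).symm)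
    · exact ih h

/-- Processing a dart equalises the labels of its ends, and later merges never separate equal
labels. -/
theorem labels_eq_of_mem {l : List D} {d : D} (h : d ∈ l) :
    G.labels l (G.vert d) = G.labels l (G.vert (G.inv d)) := by
  induction l using List.reverseRecOn with
  | nil => simp at h
  | append_singleton l e ih =>
    rw [labels_append]
    unfold mergeLabels
    rw [List.mem_append, List.mem_singleton] at h
    rcases h with h | rfl
    · rw [ih h]
    · rw [if_pos rfl]
      split_ifs <;> rfl

theorem labels_eq_iff {l : List D} (hl : ∀ d, d ∈ l) {u v : V} :
    G.labels l u = G.labels l v ↔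
      G.adjGraph.connectedComponentMk u = G.adjGraph.connectedComponentMk v := by
  rw [SimpleGraph.ConnectedComponent.eq]
  refine ⟨G.reachable_of_labels_eq l, fun h => ?_⟩
  obtain ⟨w⟩ := h
  induction w with
  | nil => rfl
  | cons hadj _ ih =>
    obtain ⟨_, d, rfl, rfl⟩ := hadj
    rw [G.labels_eq_of_mem (hl d), ih]

end

/-! ### Components as renumbered graphs. -/

variable {a b : ℕ} (G : DartGraph (Fin a) (Fin b))

/-- The final labels: two vertices have the same label if and only if they are connected. -/
def label : Fin a → Fin a := G.labels (List.finRange b)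

/-- The vertices with label `r`. -/
def labelVerts (r : Fin a) : List (Fin a) :=
  (List.finRange a).filter fun v => decide (G.label v = r)

/-- The darts at vertices with label `r`. -/
def labelDarts (r : Fin a) : List (Fin b) :=
  (List.finRange b).filter fun d => decide (G.label (G.vert d) = r)

/-- One vertex of every component. -/
def roots : List (Fin a) := (List.finRange a).filter fun v => decide (G.label v = v)

theorem label_eq_iff {u v : Fin a} : G.label u = G.label v ↔
    G.adjGraph.connectedComponentMk u = G.adjGraph.connectedComponentMk v :=
  G.labels_eq_iff List.mem_finRange

variable {G} {r : Fin a}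

@[simp] theorem mem_labelVerts {v : Fin a} : v ∈ G.labelVerts r ↔ G.label v = r := by
  simp [labelVerts]

@[simp] theorem mem_labelDarts {d : Fin b} : d ∈ G.labelDarts r ↔ G.label (G.vert d) = r := by
  simp [labelDarts]

theorem nodup_labelVerts : (G.labelVerts r).Nodup := (List.nodup_finRange a).filter _

theorem nodup_labelDarts : (G.labelDarts r).Nodup := (List.nodup_finRange b).filter _

@[simp] theorem mem_roots : r ∈ G.roots ↔ G.label r = r := by
  simp [roots]

theorem label_vert_inv (d : Fin b) : G.label (G.vert (G.inv d)) = G.label (G.vert d) :=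
  (G.labels_eq_of_mem (List.mem_finRange d)).symm

theorem inv_mem_labelDarts {d : Fin b} (h : d ∈ G.labelDarts r) : G.inv d ∈ G.labelDarts r := by
  rw [mem_labelDarts] at *
  rw [label_vert_inv, h]

variable (G r) in
/-- The subgraph on the vertices with label `r`. -/
def labelGraph : DartGraph (Fin (G.labelVerts r).length) (Fin (G.labelDarts r).length) where
  vert i := ⟨(G.labelVerts r).idxOf (G.vert (G.labelDarts r)[i]), List.idxOf_lt_length_of_mem
    (mem_labelVerts.2 (mem_labelDarts.1 (List.getElem_mem _)))⟩
  inv i := ⟨(G.labelDarts r).idxOf (G.inv (G.labelDarts r)[i]), List.idxOf_lt_length_of_mem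
    (inv_mem_labelDarts (List.getElem_mem _))⟩
  inv_inv i := by
    ext
    simp only [Fin.getElem_fin, List.getElem_idxOf, G.inv_inv]
    exact nodup_labelDarts.idxOf_getElem _ _

theorem mem_supp_iff (hr : r ∈ G.roots) {v : Fin a} :
    v ∈ G.labelVerts r ↔ v ∈ (G.adjGraph.connectedComponentMk r).supp := by
  rw [mem_roots] at hr
  rw [SimpleGraph.ConnectedComponent.mem_supp_iff, ← label_eq_iff, mem_labelVerts, hr]

theorem mem_compDarts_iff (hr : r ∈ G.roots) {d : Fin b} :
    d ∈ G.labelDarts r ↔ d ∈ G.compDarts (G.adjGraph.connectedComponentMk r) := by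
  rw [mem_labelDarts, ← mem_labelVerts, mem_supp_iff hr]
  rfl

theorem length_labelVerts (hr : r ∈ G.roots) :
    (G.labelVerts r).length = Nat.card (G.adjGraph.connectedComponentMk r).supp := by
  rw [← Nat.card_congr (Equiv.subtypeEquivRight fun v => mem_supp_iff (v := v) hr),
    ← Nat.card_congr (nodup_labelVerts.getEquiv), Nat.card_fin]

/-- The lists of vertices and darts have no repetitions, so indexing into them is an isomorphism
onto the component. -/
theorem labelGraph_covers_iff {V' D' : Type*} {H : DartGraph V' D'} (hr : r ∈ G.roots) :
    (G.labelGraph r).Covers H ↔ (G.component (G.adjGraph.connectedComponentMk r)).Covers H :=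
  covers_congr
    ((nodup_labelVerts.getEquiv).trans (Equiv.subtypeEquivRight fun _ => mem_supp_iff hr))
    ((nodup_labelDarts.getEquiv).trans (Equiv.subtypeEquivRight fun _ => mem_compDarts_iff hr))
    (fun d => Subtype.ext (by simp [labelGraph, component]))
    (fun d => Subtype.ext (by simp [labelGraph, component]))

variable (G) in
/-- The numbering of the components by the list of their roots. -/
noncomputable def rootEquiv : Fin G.roots.length ≃ G.Component :=
  Equiv.ofBijective (fun i => G.adjGraph.connectedComponentMk G.roots[i]) <| by
    constructor
    · intro i j hij
      have hi := mem_roots.1 (List.getElem_mem (l := G.roots) i.2)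
      have hj := mem_roots.1 (List.getElem_mem (l := G.roots) j.2)
      have h := G.label_eq_iff.2 hij
      have h' : G.roots[(i : ℕ)] = G.roots[(j : ℕ)] := hi.symm.trans (h.trans hj)
      exact Fin.ext (((List.nodup_finRange a).filter _).getElem_inj_iff.1 h')
    · intro c
      induction c using SimpleGraph.ConnectedComponent.ind with | _ v => ?_
      have hv : G.label v ∈ G.roots := mem_roots.2 (G.labels_idem _ v)
      obtain ⟨i, hi, he⟩ := List.getElem_of_mem hv
      refine ⟨⟨i, hi⟩, ?_⟩
      rw [← label_eq_iff]
      simp only [Fin.getElem_fin, he]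
      exact G.labels_idem _ v

theorem labelGraph_size_le : (G.labelGraph r).size ≤ a + b := by
  refine (size_le _).trans ?_
  rw [Nat.card_fin, Nat.card_fin]
  exact Nat.add_le_add ((List.length_filter_le _ _).trans_eq List.length_finRange)
    ((List.length_filter_le _ _).trans_eq List.length_finRange)

end DartGraph

/-! ### Computing the covering pattern -/

namespace GCtx

theorem a_le_size (γ : GCtx) : γ.a ≤ γ.size := by
  simp [size, DartGraph.size]

theorem b_le_size (γ : GCtx) : γ.b ≤ 2 * γ.size := by
  have h := γ.G.card_darts_le
  rw [Nat.card_fin] at h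
  exact h.trans (Nat.mul_le_mul_left _ (Nat.le_add_left _ _))

theorem ncomp_a : NComp size env a := ⟨PComp.id.hd, PBound.self.mono a_le_size⟩

/-- The encoding of a dart. -/
def encDart (γ : GCtx) (d : Fin γ.b) : Val :=
  Val.cons (Val.ofNat (γ.G.vert d)) (Val.ofNat (γ.G.inv d))

theorem pcomp_darts : PComp size env (fun γ => Val.ofList (List.ofFn γ.encDart)) := PComp.id.tl

theorem pbound_b : PBound size b :=
  (PBound.self.add PBound.self).mono fun γ => by have := γ.b_le_size; omega

theorem lcomp_darts : LComp (α := fun γ => Fin γ.b) size env encDart (fun γ => List.finRange γ.b) :=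
  ⟨pcomp_darts.congr (fun _ => rfl) fun _ => by rw [List.ofFn_eq_map], by simpa using pbound_b⟩

theorem ncomp_b : NComp size env b := by
  simpa using lcomp_darts.length

variable {Γ : Type} {N : Γ → ℕ} {env' : Γ → Val} {γ : Γ → GCtx}

theorem pcomp_vert (h : PComp N env' (fun p => Val.ofList (List.ofFn (γ p).encDart)))
    (hN : PBound N (fun p => (γ p).b)) {d : ∀ p, Fin (γ p).b}
    (hd : PComp N env' (fun p => Val.ofNat (d p))) :
    PComp N env' (fun p => Val.ofNat ((γ p).G.vert (d p))) := (PComp.get hN h hd).hd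

theorem pcomp_inv (h : PComp N env' (fun p => Val.ofList (List.ofFn (γ p).encDart)))
    (hN : PBound N (fun p => (γ p).b)) {d : ∀ p, Fin (γ p).b}
    (hd : PComp N env' (fun p => Val.ofNat (d p))) :
    PComp N env' (fun p => Val.ofNat ((γ p).G.inv (d p))) := (PComp.get hN h hd).tl

/-- The state of the fold over the darts is the whole table of current labels, which each dart
rewrites entry by entry. -/
theorem pcomp_labels : PComp size env
    (fun γ => Val.ofList (List.ofFn fun v => Val.ofNat (γ.G.label v))) := by
  refine PComp.foldl (F := fun γ l => Val.ofList (List.ofFn fun v => Val.ofNat (γ.G.labels l v)))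
    lcomp_darts ?_ ?_
  · exact (LComp.finRange ncomp_a).1.congr (fun _ => rfl) fun γ => by
      rw [List.ofFn_eq_map]; rfl
  · have hL : PComp (fun p : LCtx fun γ : GCtx => List.finRange γ.b => p.base.size)
        (fun p => Val.cons p.base.env (Val.cons (p.base.encDart p.x)
          (Val.ofList (List.ofFn fun v => Val.ofNat (p.base.G.labels p.pre v)))))
        (fun p => Val.ofList (List.ofFn fun v => Val.ofNat (p.base.G.labels p.pre v))) :=
      PComp.id.tl.tl
    have hb := ncomp_a.2.reindex fun p : LCtx fun γ : GCtx => List.finRange γ.b => p.base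
    have hu := PComp.get (i := fun p => p.base.G.vert p.x) hb hL PComp.id.tl.hd.hd
    have hw := PComp.get (i := fun p => p.base.G.vert (p.base.G.inv p.x)) hb hL
      (pcomp_vert (pcomp_darts.wk _ _) (pbound_b.reindex _) PComp.id.tl.hd.tl)
    refine (PComp.tabulate (ncomp_a.wk _ _)
      (f := fun p v => Val.ofNat (p.base.G.mergeLabels (p.base.G.labels p.pre) p.x v)) ?_).congr
        (fun _ => rfl) fun p => by simp only [DartGraph.labels_append]
    have hz := PComp.get (i := fun p : LCtx fun p : LCtx fun γ : GCtx => List.finRange γ.b =>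
      List.finRange p.base.a => p.x) (hb.reindex _) (hL.wk _ fun p => Val.ofNat p.x) PComp.id.tl
    have hN : PBound (fun p : LCtx fun p : LCtx fun γ : GCtx => List.finRange γ.b =>
      List.finRange p.base.a => p.base.base.size) (fun p => p.base.base.a) := hb.reindex _
    refine ((NComp.eq ⟨hz, hN.mono fun p => (Fin.is_lt _).le⟩
      ⟨hu.wk _ _, hN.mono fun p => (Fin.is_lt _).le⟩).ite (fun _ => Val.ofBool_ne_nil)
      (hw.wk _ _) hz).congr (fun _ => rfl) fun p => ?_
    simp only [DartGraph.mergeLabels, decide_eq_true_eq, Fin.ext_iff]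
    split_ifs <;> rfl

/-- Labels of vertices, in any context. -/
theorem pcomp_label (h : PComp N env' (fun p => Val.ofList (List.ofFn fun v =>
    Val.ofNat ((γ p).G.label v)))) (hN : PBound N (fun p => (γ p).a)) {v : ∀ p, Fin (γ p).a}
    (hv : PComp N env' (fun p => Val.ofNat (v p))) :
    NComp N env' (fun p => (γ p).G.label (v p)) :=
  ⟨PComp.get hN h hv, hN.mono fun _ => (Fin.is_lt _).le⟩

theorem lcomp_roots : LComp (α := fun γ => Fin γ.a) size env (fun _ v => Val.ofNat v)
    (fun γ => γ.G.roots) := by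
  refine LComp.filter (LComp.finRange ncomp_a) ?_
  have hx : NComp (fun p : LCtx fun γ : GCtx => List.finRange γ.a => p.base.size)
      (fun p => Val.cons p.base.env (Val.ofNat p.x)) (fun p => (p.x : ℕ)) :=
    ⟨PComp.id.tl, (ncomp_a.2.reindex _).mono fun p => p.x.2.le⟩
  exact ((pcomp_label (pcomp_labels.wk _ _) (ncomp_a.2.reindex _) hx.1).eq hx).congr
    (fun _ => rfl) fun p => by simp only [Fin.ext_iff]

end GCtx

/-! ### Extracting a component and computing its weights. -/

/-- An input graph with a distinguished vertex. -/
structure RCtx extends GCtx where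
  r : Fin a

namespace RCtx

/-- The size of the graph. -/
noncomputable def size (γ : RCtx) : ℕ := γ.toGCtx.size

/-- The encoding of a graph with a distinguished vertex. -/
def env (γ : RCtx) : Val := Val.cons γ.toGCtx.env (Val.ofNat γ.r)

/-- The subgraph on the vertices that have the distinguished vertex as their label. -/
def sub (γ : RCtx) : GCtx := ⟨_, _, γ.G.labelGraph γ.r⟩

theorem wk {e : GCtx → Val} (h : PComp GCtx.size GCtx.env e) :
    PComp size env (fun γ => e γ.toGCtx) := h.wk _ _

theorem nwk {n : GCtx → ℕ} (h : NComp GCtx.size GCtx.env n) :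
    NComp size env (fun γ => n γ.toGCtx) := h.wk _ _

theorem ncomp_r : NComp size env (fun γ => (γ.r : ℕ)) :=
  ⟨PComp.id.tl, (nwk GCtx.ncomp_a).2.mono fun γ => γ.r.2.le⟩

theorem lcomp_labelVerts : LComp (α := fun γ : RCtx => Fin γ.a) size env (fun _ v => Val.ofNat v)
    (fun γ => γ.G.labelVerts γ.r) := by
  refine LComp.filter (LComp.finRange (nwk GCtx.ncomp_a)) ?_
  exact ((GCtx.pcomp_label ((wk GCtx.pcomp_labels).wk _ _) ((nwk GCtx.ncomp_a).2.reindex _)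
    PComp.id.tl).eq (ncomp_r.wk _ _)).congr (fun _ => rfl) fun p => by simp only [Fin.ext_iff]

theorem lcomp_labelDarts : LComp (α := fun γ : RCtx => Fin γ.b) size env (fun _ v => Val.ofNat v)
    (fun γ => γ.G.labelDarts γ.r) := by
  refine LComp.filter (LComp.finRange (nwk GCtx.ncomp_b)) ?_
  exact ((GCtx.pcomp_label ((wk GCtx.pcomp_labels).wk _ _) ((nwk GCtx.ncomp_a).2.reindex _)
    (GCtx.pcomp_vert ((wk GCtx.pcomp_darts).wk _ _) ((nwk GCtx.ncomp_b).2.reindex _)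
      PComp.id.tl)).eq (ncomp_r.wk _ _)).congr (fun _ => rfl) fun p => by simp only [Fin.ext_iff]

/-- Renumbering is a search for the index in the list of vertices or darts of the component. -/
theorem pcomp_sub : PComp size env (fun γ => γ.sub.env) := by
  refine lcomp_labelVerts.length.1.cons ((PComp.map (β := fun _ => Val) (enc' := fun _ v => v)
    (f := fun γ d => Val.cons (Val.ofNat ((γ.G.labelVerts γ.r).idxOf (γ.G.vert d)))
      (Val.ofNat ((γ.G.labelDarts γ.r).idxOf (γ.G.inv d)))) lcomp_labelDarts ?_).congr
    (fun _ => rfl) fun γ => ?_)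
  · have ha := (nwk GCtx.ncomp_a).2.reindex fun p : LCtx fun γ : RCtx => γ.G.labelDarts γ.r =>
      p.base
    have hb := (nwk GCtx.ncomp_b).2.reindex fun p : LCtx fun γ : RCtx => γ.G.labelDarts γ.r =>
      p.base
    have hd : PComp (fun p : LCtx fun γ : RCtx => γ.G.labelDarts γ.r => p.base.size)
      (fun p => Val.cons p.base.env (Val.ofNat p.x))
      (fun p => Val.ofList (List.ofFn p.base.encDart)) := (wk GCtx.pcomp_darts).wk _ _
    have hv := GCtx.pcomp_vert hd hb (d := fun p => p.x) PComp.id.tl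
    have hi := GCtx.pcomp_inv hd hb (d := fun p => p.x) PComp.id.tl
    have hV := lcomp_labelVerts.wk (fun p : LCtx fun γ : RCtx => γ.G.labelDarts γ.r => p.base)
      fun p => Val.ofNat p.x
    have hD := lcomp_labelDarts.wk (fun p : LCtx fun γ : RCtx => γ.G.labelDarts γ.r => p.base)
      fun p => Val.ofNat p.x
    refine (hV.idxOf (x := fun p => p.base.G.vert p.x) ?_).1.cons
      (hD.idxOf (x := fun p => p.base.G.inv p.x) ?_).1
    · exact (NComp.eq ⟨PComp.id.tl, (ha.reindex _).mono fun p => (Fin.is_lt p.x).le⟩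
        ⟨hv.wk _ _, (ha.reindex _).mono fun p => (Fin.is_lt _).le⟩).congr
        (fun _ => rfl) fun p => by simp only [Fin.ext_iff]
    · exact (NComp.eq ⟨PComp.id.tl, (hb.reindex _).mono fun p => (Fin.is_lt p.x).le⟩
        ⟨hi.wk _ _, (hb.reindex _).mono fun p => (Fin.is_lt _).le⟩).congr
        (fun _ => rfl) fun p => by simp only [Fin.ext_iff]
  · rw [List.map_id', ← List.ofFn_getElem_eq_map]
    rfl

theorem pbound_sub : PBound size (fun γ => γ.sub.size) :=
  ((nwk GCtx.ncomp_a).2.add (nwk GCtx.ncomp_b).2).mono fun _ => DartGraph.labelGraph_size_le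

open Classical in
/-- The weight of the component of the distinguished vertex and a component of `H`. -/
noncomputable def weight {V' D' : Type*} (H : DartGraph V' D') (c : H.Component) (γ : RCtx) : ℕ :=
  if γ.sub.G.Covers (H.component c) then γ.sub.a / Nat.card c.supp else 0

open Classical in
-- The solver runs on the extracted graph, whose size is polynomially bounded by `pbound_sub`. The
-- divisor depends only on `H`, so division by a constant is enough.
theorem pcomp_weight {V' D' : Type*} [Finite V'] (H : DartGraph V' D') (c : H.Component)
    (hc : PolyTimeSolvable (CoverProblem (H.component c))) :
    PComp size env (fun γ => Val.ofNat (γ.weight H c)) := by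
  obtain ⟨P, hP⟩ := hc
  have h1 := pcomp_sub.comp ((hP.pcomp.reindex RCtx.sub).change pbound_sub)
  exact (h1.ite (fun _ => Val.ofBool_ne_nil)
    (lcomp_labelVerts.length.divConst _ (DartGraph.card_supp_pos c)).1 (.const .nil)).congr
    (fun _ => rfl) fun γ => by
      by_cases hγ : CoverProblem (H.component c) γ.sub.G
      · rw [if_pos (decide_eq_true hγ), weight,
          if_pos (show γ.sub.G.Covers (H.component c) from hγ)]
        rfl
      · rw [if_neg (by simpa using hγ), weight,
          if_neg (show ¬ γ.sub.G.Covers (H.component c) from hγ)]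
        rfl

end RCtx

open Classical in
-- For a root, the label class is the whole component; for other vertices it is empty.
theorem RCtx.weight_eq {V' D' : Type*} (H : DartGraph V' D') (c : H.Component) {γ : RCtx}
    (hr : γ.r ∈ γ.G.roots) :
    γ.weight H c = γ.G.covPattern H (γ.G.adjGraph.connectedComponentMk γ.r) c := by
  unfold weight DartGraph.covPattern
  rw [← DartGraph.length_labelVerts hr]
  exact if_congr (DartGraph.labelGraph_covers_iff hr) rfl rfl

theorem GCtx.pcomp_covPattern {V' D' : Type*} [Finite V'] (H : DartGraph V' D')
    (hH : ∀ c : H.Component, PolyTimeSolvable (CoverProblem (H.component c))) {q : ℕ}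
    (h : Fin q ≃ H.Component) :
    PComp size env (fun γ => Val.ofCovPattern γ.G H γ.G.rootEquiv h) := by
  refine (PComp.map (β := fun _ => Val) (enc' := fun _ v => v) (f := fun γ r =>
    Val.ofList (List.ofFn fun j => Val.ofNat (RCtx.weight H (h j) ⟨γ, r⟩))) lcomp_roots ?_).congr
    (fun _ => rfl) fun γ => ?_
  · exact PComp.ofFn fun j => ((RCtx.pcomp_weight H (h j) (hH _)).reindex
      fun p : LCtx fun γ : GCtx => γ.G.roots => (⟨p.base, p.x⟩ : RCtx)).congr
      (fun _ => rfl) fun _ => rfl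
  · rw [List.map_id', ← List.ofFn_getElem_eq_map, Val.ofCovPattern, Val.ofMatrix]
    congr 2
    funext i
    congr 2
    funext j
    rw [RCtx.weight_eq H (h j) (γ := ⟨γ, γ.G.roots[(i : ℕ)]⟩) (List.getElem_mem _)]
    rfl

/-! ### Sets of numbers as lists of truth values -/

namespace BoolList

/-- Union of sets of numbers. -/
def union (s t : List Bool) : List Bool :=
  s.mapIdx (fun i x => x || t.getD i false) ++ t.drop s.length

theorem getD_union (s t : List Bool) (i : ℕ) :
    (union s t).getD i false = (s.getD i false || t.getD i false) := by
  unfold union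
  rcases lt_or_ge i s.length with h | h
  · rw [List.getD_append _ _ _ _ (by simpa using h)]
    simp [List.getD_eq_getElem?_getD, h]
  · rw [List.getD_append_right _ _ _ _ (by simpa using h)]
    simp [List.getD_eq_getElem?_getD, h]

theorem length_union_le {s t : List Bool} {m : ℕ} (hs : s.length ≤ m) (ht : t.length ≤ m) :
    (union s t).length ≤ m := by
  simp only [union, List.length_append, List.length_mapIdx, List.length_drop]
  omega

/-- Union of finitely many sets of numbers. -/
def iUnion : ∀ {q : ℕ}, (Fin q → List Bool) → List Bool
  | 0, _ => []
  | _ + 1, f => union (f 0) (iUnion fun j => f j.succ)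

theorem getD_iUnion {q : ℕ} (f : Fin q → List Bool) (i : ℕ) :
    (iUnion f).getD i false = true ↔ ∃ j, (f j).getD i false = true := by
  induction q with
  | zero => simp [iUnion]
  | succ q ih => rw [iUnion, getD_union, Bool.or_eq_true, ih, Fin.exists_fin_succ]

theorem length_iUnion_le {q m : ℕ} {f : Fin q → List Bool} (h : ∀ j, (f j).length ≤ m) :
    (iUnion f).length ≤ m := by
  induction q with
  | zero => simp [iUnion]
  | succ q ih => exact length_union_le (h 0) (ih fun j => h j.succ)

/-- Translation of a set of numbers. -/
def shift (m : ℕ) (s : List Bool) : List Bool := List.replicate m false ++ s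

theorem getD_shift (m : ℕ) (s : List Bool) (i : ℕ) :
    (shift m s).getD i false = true ↔ ∃ x, s.getD x false = true ∧ i = x + m := by
  unfold shift
  rcases lt_or_ge i m with h | h
  · rw [List.getD_append _ _ _ _ (by simpa using h)]
    simp only [List.getD_eq_getElem?_getD, List.getElem?_replicate, h, if_true, Option.getD_some,
      Bool.false_eq_true, false_iff]
    rintro ⟨x, -, rfl⟩
    omega
  · rw [List.getD_append_right _ _ _ _ (by simpa using h), List.length_replicate]
    refine ⟨fun hx => ⟨i - m, hx, by omega⟩, ?_⟩
    rintro ⟨x, hx, rfl⟩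
    rwa [Nat.add_sub_cancel]

/-- One step of the dynamic program: add one weight of a row, as a digit in base `M`. -/
def addRow {q : ℕ} (M : ℕ) (s : List Bool) (row : Fin q → ℕ) : List Bool :=
  iUnion fun j : Fin q => if row j ≠ 0 then shift (row j * M ^ (j : ℕ)) s else []

/-- The sums of weights, one from every row, each as a digit in base `M`. -/
def table {q : ℕ} (M : ℕ) (l : List (Fin q → ℕ)) : List Bool := l.foldl (addRow M) [true]

theorem table_append {q : ℕ} (M : ℕ) (l : List (Fin q → ℕ)) (row : Fin q → ℕ) :
    table M (l ++ [row]) = addRow M (table M l) row := by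
  simp [table]

theorem getD_addRow {q M : ℕ} {s : List Bool} {row : Fin q → ℕ} {i : ℕ} :
    (addRow M s row).getD i false = true ↔
      ∃ j, row j ≠ 0 ∧ ∃ x, s.getD x false = true ∧ i = x + row j * M ^ (j : ℕ) := by
  rw [addRow, getD_iUnion]
  refine exists_congr fun j => ?_
  split_ifs with h
  · rw [getD_shift]; simp [h]
  · simp [h]

theorem getD_table {p q M : ℕ} (r : Fin p → Fin q → ℕ) (x : ℕ) :
    (table M (List.ofFn r)).getD x false = true ↔
      ∃ φ : Fin p → Fin q, (∀ i, r i (φ i) ≠ 0) ∧ x = ∑ i, r i (φ i) * M ^ (φ i : ℕ) := by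
  induction p generalizing x with
  | zero => cases x <;> simp [table]
  | succ p ih =>
    -- The table is a left fold, so the last row is split off.
    rw [List.ofFn_succ', List.concat_eq_append, table_append, getD_addRow]
    constructor
    · rintro ⟨j, hj, y, hy, rfl⟩
      obtain ⟨φ, h1, rfl⟩ := (ih _ _).1 hy
      refine ⟨Fin.snoc φ j, fun i => ?_, ?_⟩
      · induction i using Fin.lastCases with
        | last => simpa using hj
        | cast i => simpa using h1 i
      · simp [Fin.sum_univ_castSucc]
    · rintro ⟨φ, h1, rfl⟩
      refine ⟨φ (Fin.last p), h1 _, _, (ih _ _).2 ⟨fun i => φ i.castSucc, fun i => h1 _, rfl⟩, ?_⟩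
      rw [Fin.sum_univ_castSucc]

/-- The sum of all weights. -/
def total {q : ℕ} (l : List (Fin q → ℕ)) : ℕ := (l.map fun row => ∑ j, row j).sum

/-- Column indices are at most `q - 1`, so every shift is at most the row sum times `M ^ (q - 1)`.
-/
theorem length_addRow_le {q M : ℕ} (hM : 0 < M) (s : List Bool) (row : Fin q → ℕ) :
    (addRow M s row).length ≤ s.length + (∑ j, row j) * M ^ (q - 1) := by
  refine length_iUnion_le fun j => ?_
  split_ifs
  · rw [shift, List.length_append, List.length_replicate, add_comm]
    refine Nat.add_le_add_left (Nat.mul_le_mul ?_ (Nat.pow_le_pow_right hM (by omega))) _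
    exact Finset.single_le_sum (f := row) (fun _ _ => Nat.zero_le _) (Finset.mem_univ j)
  · simp

theorem length_table_le {q M : ℕ} (hM : 0 < M) (l : List (Fin q → ℕ)) :
    (table M l).length ≤ 1 + total l * M ^ (q - 1) := by
  induction l using List.reverseRecOn with
  | nil => simp [table, total]
  | append_singleton l row ih =>
    rw [table_append]
    refine (length_addRow_le hM _ _).trans ?_
    simp only [total, List.map_append, List.sum_append, List.map_cons, List.map_nil,
      List.sum_cons, List.sum_nil, add_zero, add_mul] at *
    omega

end BoolList

/-- Uniqueness of base-`M` digits: compare residues modulo `M`, cancel the lowest digit and divide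
by `M`. -/
theorem eq_of_sum_mul_pow_eq {q M : ℕ} {f g : Fin q → ℕ} (hf : ∀ j, f j < M) (hg : ∀ j, g j < M)
    (h : ∑ j, f j * M ^ (j : ℕ) = ∑ j, g j * M ^ (j : ℕ)) : f = g := by
  induction q with
  | zero => exact Subsingleton.elim _ _
  | succ q ih =>
    have hM : 0 < M := (Nat.zero_le _).trans_lt (hf 0)
    simp only [Fin.sum_univ_succ, Fin.val_zero, pow_zero, mul_one, Fin.val_succ, pow_succ,
      ← mul_assoc, ← Finset.sum_mul] at h
    have h0 : f 0 = g 0 := by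
      have := congrArg (· % M) h
      simpa [Nat.add_mul_mod_self_right, Nat.mod_eq_of_lt (hf 0), Nat.mod_eq_of_lt (hg 0)] using this
    have h1 := ih (f := fun j => f j.succ) (g := fun j => g j.succ) (fun j => hf _) (fun j => hg _)
      (Nat.eq_of_mul_eq_mul_right hM (by omega))
    funext j
    cases j using Fin.cases with
    | zero => exact h0
    | succ j => exact congrFun h1 j

/-! ### The dynamic program -/

namespace Val

/-- The encoding of a list of truth values. -/
def ofBools (s : List Bool) : Val := ofList (s.map ofBool)

/-- Past the end this works because `nil` is both the head of `nil` and the code of `false`. -/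
theorem hd_ofBools_drop (s : List Bool) (i : ℕ) :
    (ofBools (s.drop i)).hd = ofBool (s.getD i false) := by
  rcases lt_or_ge i s.length with h | h
  · rw [List.drop_eq_getElem_cons h, List.getD_eq_getElem _ _ h]; rfl
  · rw [List.drop_eq_nil_of_le h, List.getD_eq_default _ _ h]; rfl

theorem tl_ofBools_drop (s : List Bool) (i : ℕ) :
    (ofBools (s.drop i)).tl = ofBools (s.drop (i + 1)) := by
  rw [ofBools, tl_ofList, ← List.map_tail, List.tail_drop]; rfl

end Val

namespace Comp

variable {Γ : Type} {N : Γ → ℕ} {k d d' c c' : ℕ} {env : Γ → Val}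

theorem natMul {i j : Γ → ℕ} (hi : ∀ γ, i γ ≤ c * (N γ + 1) ^ d)
    (hj : ∀ γ, j γ ≤ c' * (N γ + 1) ^ d')
    (h₁ : Comp N (d + d') env (fun γ => Val.ofNat (i γ)))
    (h₂ : Comp N (d + d') env (fun γ => Val.ofNat (j γ))) :
    Comp N (d + d') env (fun γ => Val.ofNat (i γ * j γ)) := by
  -- Both factors are computed once and become the environment of the loop, so that a round costs
  -- only one addition, of exponent `d'`.
  refine (h₁.cons h₂).comp (natRec (F := fun γ t => Val.ofNat (t * j γ)) hi id.hd
    (nil.congr (fun _ => rfl) fun γ => by simp) ?_)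
  exact (natAdd (c := c') (i := fun p : NCtx i => p.i * j p.base) (j := fun p => j p.base)
    (fun p => hj p.base) id.tl id.hd.tl).congr (fun _ => rfl) fun p => by rw [add_mul, one_mul]

/-- An entry of a list of fixed length. -/
theorem get {q : ℕ} {f : Γ → Fin q → Val}
    (h : Comp N k env (fun γ => Val.ofList (List.ofFn (f γ)))) (j : Fin q) :
    Comp N k env (fun γ => f γ j) := by
  induction q with
  | zero => exact j.elim0
  | succ q ih =>
    simp only [List.ofFn_succ, Val.ofList_cons] at h
    cases j using Fin.cases with
    | zero => exact h.hd
    | succ j => exact ih (f := fun γ j => f γ j.succ) h.tl j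

theorem natSum {q : ℕ} {t : Γ → ℕ} {f : Γ → Fin q → ℕ} (hf : ∀ γ j, f γ j ≤ c * (N γ + 1) ^ d)
    (ht : Comp N d env (fun γ => Val.ofNat (t γ)))
    (h : ∀ j, Comp N d env (fun γ => Val.ofNat (f γ j))) :
    Comp N d env (fun γ => Val.ofNat (t γ + ∑ j, f γ j)) := by
  induction q generalizing t with
  | zero => simpa using ht
  | succ q ih =>
    simpa [Fin.sum_univ_succ, add_assoc] using ih (f := fun γ j => f γ j.succ)
      (fun γ j => hf γ _) (natAdd (fun γ => hf γ 0) ht (h 0)) fun j => h j.succ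

/-- Two passes whose rounds are counted by `s`: the first consumes `t` in step with `s` and collects
the merged entries in reverse; the second puts them back in front of what remains of `t`. -/
theorem union {s t : Γ → List Bool} (hs : ∀ γ, (s γ).length ≤ c * (N γ + 1) ^ d)
    (h₁ : Comp N d env (fun γ => Val.ofBools (s γ)))
    (h₂ : Comp N d env (fun γ => Val.ofBools (t γ))) :
    Comp N d env (fun γ => Val.ofBools (BoolList.union (s γ) (t γ))) := by
  have h : Comp N d env (fun γ => Val.cons (Val.ofBools ((t γ).drop (s γ).length))
      (Val.ofBools ((s γ).mapIdx fun i x => x || (t γ).getD i false).reverse)) := by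
    refine foldl (k := 0) (α := fun _ => Bool) (enc := fun _ => Val.ofBool)
      (F := fun γ l => Val.cons (Val.ofBools ((t γ).drop l.length))
        (Val.ofBools (l.mapIdx fun i x => x || (t γ).getD i false).reverse)) hs h₁
      ((h₂.cons nil).congr (fun _ => rfl) fun γ => by simp [Val.ofBools]) ?_
    have hx : Comp (fun p : LCtx s => N p.base) 0 (fun p => Val.cons (env p.base)
        (Val.cons (Val.ofBool p.x) (Val.cons (Val.ofBools ((t p.base).drop p.pre.length))
          (Val.ofBools (p.pre.mapIdx fun i x => x || (t p.base).getD i false).reverse))))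
        (fun p => Val.ofBool p.x) := id.tl.hd
    refine (id.tl.tl.hd.tl.cons ((hx.or (id.tl.tl.hd.hd.congr (fun _ => rfl) fun p =>
      Val.hd_ofBools_drop (t p.base) p.pre.length)).cons id.tl.tl.tl)).congr (fun _ => rfl)
      fun p => ?_
    rw [List.mapIdx_concat, List.reverse_append, List.length_append]
    exact congrArg₂ _ (Val.tl_ofBools_drop _ _) rfl
  refine (foldl (k := 0) (α := fun _ => Bool) (enc := fun _ => Val.ofBool)
    (l := fun γ => ((s γ).mapIdx fun i x => x || (t γ).getD i false).reverse)
    (F := fun γ l => Val.ofBools (l.reverse ++ (t γ).drop (s γ).length))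
    (by simpa using hs) h.tl h.hd
    ((id.tl.hd.cons id.tl.tl).congr (fun _ => rfl) fun p => ?_)).congr (fun _ => rfl) fun γ => ?_
  · simp [Val.ofBools]
  · rw [List.reverse_reverse]; rfl

theorem iUnion {q : ℕ} {s : Γ → Fin q → List Bool}
    (hs : ∀ γ j, (s γ j).length ≤ c * (N γ + 1) ^ d)
    (h : ∀ j, Comp N d env (fun γ => Val.ofBools (s γ j))) :
    Comp N d env (fun γ => Val.ofBools (BoolList.iUnion (s γ))) := by
  induction q with
  | zero => exact nil
  | succ q ih => exact (h 0).union (fun γ => hs γ 0) (ih (fun γ j => hs γ _) fun j => h _)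

theorem shift {s : Γ → List Bool} {m : Γ → ℕ} (hm : ∀ γ, m γ ≤ c * (N γ + 1) ^ d)
    (h₁ : Comp N d env (fun γ => Val.ofNat (m γ)))
    (h₂ : Comp N d env (fun γ => Val.ofBools (s γ))) :
    Comp N d env (fun γ => Val.ofBools (BoolList.shift (m γ) (s γ))) :=
  natRec (k := 0) (F := fun γ t => Val.ofBools (BoolList.shift t (s γ))) hm h₁ h₂
    ((nil.cons id.tl).congr (fun _ => rfl) fun _ => rfl)

end Comp

/-! ### Weight matrices: encoding in base `M` and running time. -/

/-- Weight matrices with column sums bounded by `n`. -/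
structure MCtx (q : ℕ) where
  n : ℕ
  p : ℕ
  r : Fin p → Fin q → ℕ
  p_le : p ≤ n
  sum_le : ∀ j, ∑ i, r i j ≤ n

namespace MCtx

variable {q : ℕ}

/-- The encoding of a matrix. -/
def env (γ : MCtx q) : Val := Val.ofMatrix γ.r

/-- The encoding of a row. -/
def encRow (row : Fin q → ℕ) : Val := Val.ofList (List.ofFn fun j => Val.ofNat (row j))

/-- The rows of a matrix. -/
def rows (γ : MCtx q) : List (Fin q → ℕ) := List.ofFn γ.r

/-- A base that exceeds all sums of weights. -/
def M (γ : MCtx q) : ℕ := BoolList.total γ.rows + 1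

/-- One entry per row can be chosen such that the chosen entries are positive and have equal sums
in all columns. -/
def Solvable (γ : MCtx q) : Prop := ∃ (φ : Fin γ.p → Fin q) (k : ℕ), (∀ i, γ.r i (φ i) ≠ 0) ∧
  ∀ j, ∑ i with φ i = j, γ.r i j = k

theorem total_rows (γ : MCtx q) : BoolList.total γ.rows = ∑ i, ∑ j, γ.r i j := by
  rw [BoolList.total, rows, List.map_ofFn, List.sum_ofFn]
  rfl

theorem M_le (γ : MCtx q) : γ.M ≤ (q + 1) * (γ.n + 1) := by
  have h : ∑ i, ∑ j, γ.r i j ≤ q * γ.n := by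
    rw [Finset.sum_comm]
    refine (Finset.sum_le_sum fun j _ => γ.sum_le j).trans ?_
    simp
  rw [M, total_rows]
  nlinarith

theorem M_pow_le (γ : MCtx q) (j : ℕ) : γ.M ^ j ≤ (q + 1) ^ j * (γ.n + 1) ^ j := by
  rw [← mul_pow]
  exact Nat.pow_le_pow_left γ.M_le j

/-- Grouping the rows by chosen column shows that the digits of a reachable number are the column
sums. All are below `M`, so the number equals `k * ∑ M ^ j` exactly when every column sum is `k`.
Positivity of `q` bounds `k`, which is then a column sum itself. -/
theorem solvable_iff (hq : 0 < q) (γ : MCtx q) : γ.Solvable ↔ ∃ k < γ.M,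
    (BoolList.table γ.M γ.rows).getD (k * ∑ j : Fin q, γ.M ^ (j : ℕ)) false = true := by
  have hlt : ∀ (φ : Fin γ.p → Fin q) (j : Fin q), ∑ i with φ i = j, γ.r i j < γ.M := fun φ j => by
    rw [M, total_rows, Nat.lt_succ_iff]
    refine (Finset.sum_le_sum_of_subset (Finset.subset_univ _)).trans
      (Finset.sum_le_sum fun i _ => ?_)
    exact Finset.single_le_sum (f := fun j => γ.r i j) (fun _ _ => Nat.zero_le _)
      (Finset.mem_univ j)
  have hsum : ∀ φ : Fin γ.p → Fin q, ∑ i, γ.r i (φ i) * γ.M ^ (φ i : ℕ) =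
      ∑ j : Fin q, (∑ i with φ i = j, γ.r i j) * γ.M ^ (j : ℕ) := fun φ => by
    rw [← Finset.sum_fiberwise Finset.univ φ]
    refine Finset.sum_congr rfl fun j _ => ?_
    rw [Finset.sum_mul]
    refine Finset.sum_congr rfl fun i hi => ?_
    rw [(Finset.mem_filter.1 hi).2]
  simp only [rows, BoolList.getD_table]
  constructor
  · rintro ⟨φ, k, h1, h2⟩
    refine ⟨k, h2 ⟨0, hq⟩ ▸ hlt φ ⟨0, hq⟩, φ, h1, ?_⟩
    rw [hsum, Finset.mul_sum]
    exact Finset.sum_congr rfl fun j _ => by rw [h2]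
  · rintro ⟨k, hk, φ, h1, h2⟩
    rw [hsum, Finset.mul_sum] at h2
    exact ⟨φ, k, h1, fun j => congrFun (eq_of_sum_mul_pow_eq (hlt φ) (fun _ => hk) h2.symm) j⟩

theorem entry_le (γ : MCtx q) {row : Fin q → ℕ} (h : row ∈ γ.rows) (j : Fin q) :
    row j ≤ 1 * (γ.n + 1) ^ 1 := by
  obtain ⟨i, rfl⟩ := (List.mem_ofFn' γ.r row).1 h
  have := (Finset.single_le_sum (f := fun i => γ.r i j) (fun _ _ => Nat.zero_le _)
    (Finset.mem_univ i)).trans (γ.sum_le j)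
  simp only [pow_one, one_mul]
  exact this.trans (Nat.le_succ _)

theorem length_rows_le (γ : MCtx q) : γ.rows.length ≤ 1 * (γ.n + 1) ^ 1 := by
  have := γ.p_le
  simp only [rows, List.length_ofFn, pow_one]
  omega

theorem env_eq (γ : MCtx q) : γ.env = Val.ofList (γ.rows.map encRow) := by
  rw [rows, List.map_ofFn]; rfl

theorem comp_M : Comp n 2 env (fun γ : MCtx q => Val.ofNat γ.M) := by
  refine (Comp.foldl (k := 1) (α := fun _ => Fin q → ℕ) (enc := fun _ => encRow) (l := rows)
    (F := fun γ l => Val.ofNat (BoolList.total l)) length_rows_le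
    (Comp.id.congr (fun _ => rfl) env_eq) Comp.nil ?_).succ
  have hrow : Comp (fun p : LCtx (α := fun _ => Fin q → ℕ) (rows (q := q)) => p.base.n) 1
    (fun p => Val.cons p.base.env (Val.cons (encRow p.x) (Val.ofNat (BoolList.total p.pre))))
    (fun p => encRow p.x) := Comp.id.tl.hd
  exact (Comp.natSum (c := 1) (f := fun p => p.x) (t := fun p => BoolList.total p.pre)
    (fun p j => p.base.entry_le p.mem j) Comp.id.tl.tl fun j => hrow.get j).congr (fun _ => rfl)
    fun p => by simp [BoolList.total]

theorem comp_M_pow (j : ℕ) : Comp n (max 2 j) env (fun γ : MCtx q => Val.ofNat (γ.M ^ j)) := by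
  induction j with
  | zero => simpa using Comp.const (Val.ofNat 1)
  | succ j ih =>
    -- For `j = 0` the product rule would allow exponent `1` only, less than the exponent `2` used
    -- for `M` itself.
    rcases Nat.eq_zero_or_pos j with rfl | hj
    · simpa using comp_M
    · have := Comp.natMul (d := j) (d' := 1) (fun γ : MCtx q => γ.M_pow_le j) (fun γ : MCtx q => by simpa using γ.M_le)
        (ih.mono (by omega)) (comp_M.mono (by omega))
      simpa [pow_succ] using this.mono (by omega)

/-- A matrix together with the powers of the base. -/
def env' (γ : MCtx q) : Val :=
  Val.cons γ.env (Val.ofList (List.ofFn fun j : Fin q => Val.ofNat (γ.M ^ (j : ℕ))))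

/-- The weights in a prefix sum to at most `M - 1`, hence `1 + (M - 1) * M ^ (q - 1) ≤ M ^ q`. -/
theorem length_table_le (hq : 0 < q) (γ : MCtx q) {l : List (Fin q → ℕ)} (hl : l <+: γ.rows) :
    (BoolList.table γ.M l).length ≤ γ.M ^ q := by
  refine (BoolList.length_table_le (M := γ.M) (Nat.succ_pos _) l).trans ?_
  have h : BoolList.total l ≤ BoolList.total γ.rows := (hl.sublist.map _).sum_le_sum
    fun _ _ => Nat.zero_le _
  obtain ⟨q, rfl⟩ := Nat.exists_eq_succ_of_ne_zero hq.ne'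
  have h1 : 0 < γ.M ^ q := pow_pos (Nat.succ_pos _) _
  have h2 : BoolList.total l + 1 ≤ γ.M := Nat.succ_le_succ h
  rw [Nat.succ_sub_one, pow_succ]
  nlinarith

/-- At most `n` rounds, each with `q` shifts and unions of lists of length `O(n ^ q)`. The powers of
`M` come precomputed in `env'`, so a round only multiplies them by entries. -/
theorem comp_table (hq : 0 < q) : Comp n (1 + q) env'
    (fun γ : MCtx q => Val.ofBools (BoolList.table γ.M γ.rows)) := by
  refine Comp.foldl (α := fun _ => Fin q → ℕ) (enc := fun _ => encRow) (l := rows)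
    (F := fun γ l => Val.ofBools (BoolList.table γ.M l)) length_rows_le
    (Comp.id.hd.congr (fun _ => rfl) env_eq) (Comp.const _) ?_
  let env₁ := fun p : LCtx (α := fun _ => Fin q → ℕ) (rows (q := q)) =>
    Val.cons p.base.env' (Val.cons (encRow p.x) (Val.ofBools (BoolList.table p.base.M p.pre)))
  have hrow : Comp (fun p => p.base.n) q env₁ (fun p => encRow p.x) := Comp.id.tl.hd
  have hpow : Comp (fun p => p.base.n) q env₁ (fun p => Val.ofList (List.ofFn fun j : Fin q =>
    Val.ofNat (p.base.M ^ (j : ℕ)))) := Comp.id.hd.tl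
  have hM : ∀ (γ : MCtx q) (j : Fin q), γ.M ^ (j : ℕ) ≤ (q + 1) ^ (q - 1) * (γ.n + 1) ^ (q - 1) :=
    fun γ j => (Nat.pow_le_pow_right (Nat.succ_pos _) (by omega)).trans (γ.M_pow_le (q - 1))
  have hmul : ∀ (p : LCtx (α := fun _ => Fin q → ℕ) (rows (q := q))) (j : Fin q),
      p.x j * p.base.M ^ (j : ℕ) ≤ (q + 1) ^ (q - 1) * (p.base.n + 1) ^ q := fun p j => by
    refine (Nat.mul_le_mul (p.base.entry_le p.mem j) (hM p.base j)).trans_eq ?_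
    obtain ⟨q, rfl⟩ := Nat.exists_eq_succ_of_ne_zero hq.ne'
    simp only [Nat.succ_sub_one, Nat.succ_eq_add_one]
    ring
  have htab : ∀ p : LCtx (α := fun _ => Fin q → ℕ) (rows (q := q)),
      (BoolList.table p.base.M p.pre).length ≤ (q + 1) ^ q * (p.base.n + 1) ^ q := fun p =>
    (length_table_le hq p.base ⟨p.x :: p.post, p.eq.symm⟩).trans (p.base.M_pow_le q)
  refine (Comp.iUnion (c := (q + 1) ^ (q - 1) + (q + 1) ^ q) (s := fun p j => if p.x j ≠ 0 then
    BoolList.shift (p.x j * p.base.M ^ (j : ℕ)) (BoolList.table p.base.M p.pre) else [])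
    (fun p j => ?_) fun j => ?_).congr (fun _ => rfl) fun p => ?_
  · split_ifs
    · rw [BoolList.shift, List.length_append, List.length_replicate, add_mul]
      exact Nat.add_le_add (hmul p j) (htab p)
    · simp
  · have hq' : 1 + (q - 1) = q := by omega
    have h1 : Comp (fun p => p.base.n) q env₁ (fun p => Val.ofNat (p.x j * p.base.M ^ (j : ℕ))) := by
      have := Comp.natMul (d := 1) (d' := q - 1)
        (fun p : LCtx (α := fun _ => Fin q → ℕ) (rows (q := q)) => p.base.entry_le p.mem j)
        (fun p => hM p.base j) (by rw [hq']; exact hrow.get j) (by rw [hq']; exact hpow.get j)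
      rwa [hq'] at this
    have h2 := (hrow.get j).ite (q := fun p => p.x j ≠ 0) (fun _ => Val.ofNat_ne_nil)
      (h1.shift (s := fun p => BoolList.table p.base.M p.pre) (fun p => hmul p j) Comp.id.tl.tl)
      Comp.nil
    refine h2.congr (fun _ => rfl) fun p => ?_
    split_ifs <;> rfl
  · rw [BoolList.table_append]; rfl

open Classical in
-- The finished table is scanned at the multiples of `∑ M ^ j`. The state holds the unread part of
-- the table and whether a hit has occurred; each of the `M` rounds drops `O(n ^ q)` entries.
theorem comp_solvable_of_pos (hq : 0 < q) :
    Comp n (1 + q) env (fun γ : MCtx q => Val.ofBool (decide γ.Solvable)) := by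
  have hpow : ∀ j : ℕ, j ≤ q → Comp n (1 + q) env (fun γ : MCtx q => Val.ofNat (γ.M ^ j)) :=
    fun j hj => (comp_M_pow j).mono (by omega)
  have hR : ∀ γ : MCtx q, ∑ j : Fin q, γ.M ^ (j : ℕ) ≤ (q * (q + 1) ^ q) * (γ.n + 1) ^ q :=
    fun γ => by
      refine (Finset.sum_le_card_nsmul _ _ (γ.M ^ q) fun j _ =>
        Nat.pow_le_pow_right (Nat.succ_pos _) j.2.le).trans ?_
      rw [Finset.card_univ, Fintype.card_fin, smul_eq_mul, mul_assoc]
      exact Nat.mul_le_mul_left _ (γ.M_pow_le q)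
  have hsum : Comp n (1 + q) env (fun γ : MCtx q => Val.ofNat (∑ j : Fin q, γ.M ^ (j : ℕ))) := by
    have := Comp.natSum (N := n) (env := env) (c := (q + 1) ^ q) (d := 1 + q) (t := fun _ => 0)
      (f := fun (γ : MCtx q) (j : Fin q) => γ.M ^ (j : ℕ))
      (fun γ j => (Nat.pow_le_pow_right (Nat.succ_pos _) j.2.le).trans ((γ.M_pow_le q).trans
        (Nat.mul_le_mul_left _ (Nat.pow_le_pow_right (Nat.succ_pos _) (by omega)))))
      Comp.nil fun j => hpow j j.2.le
    simpa using this
  have htab : Comp n (1 + q) env (fun γ : MCtx q => Val.ofBools (BoolList.table γ.M γ.rows)) :=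
    (Comp.id.cons (Comp.ofFn fun j => hpow j j.2.le)).comp (comp_table hq)
  have hM : Comp n (1 + q) env (fun γ : MCtx q => Val.ofNat γ.M) := by
    simpa using hpow 1 hq
  have key := (hsum.cons (hM.cons htab)).comp (Comp.natRec (c := q + 1) (d := 1) (k := q)
    (F := fun γ t => Val.cons (Val.ofBools ((BoolList.table γ.M γ.rows).drop
      (t * ∑ j : Fin q, γ.M ^ (j : ℕ)))) (Val.ofBool (decide (∃ k < t,
        (BoolList.table γ.M γ.rows).getD (k * ∑ j : Fin q, γ.M ^ (j : ℕ)) false = true))))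
    (fun γ => by simpa using γ.M_le) Comp.id.tl.hd
    ((Comp.id.tl.tl.cons Comp.nil).congr (fun _ => rfl) fun γ => by simp [Val.ofBool]) ?_)
  · refine key.tl.congr (fun _ => rfl) fun γ => ?_
    simp only [Val.tl_cons]
    exact congrArg Val.ofBool (decide_eq_decide.2 (solvable_iff hq γ).symm)
  · let env₁ := fun p : NCtx (M (q := q)) =>
      Val.cons (Val.cons (Val.ofNat (∑ j : Fin q, p.base.M ^ (j : ℕ))) (Val.cons
        (Val.ofNat p.base.M) (Val.ofBools (BoolList.table p.base.M p.base.rows))))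
        (Val.cons (Val.ofBools ((BoolList.table p.base.M p.base.rows).drop
          (p.i * ∑ j : Fin q, p.base.M ^ (j : ℕ)))) (Val.ofBool (decide (∃ k < p.i,
          (BoolList.table p.base.M p.base.rows).getD (k * ∑ j : Fin q, p.base.M ^ (j : ℕ)) false
            = true))))
    have h1 : Comp (fun p => p.base.n) q env₁ (fun p => Val.ofNat
      (∑ j : Fin q, p.base.M ^ (j : ℕ))) := Comp.id.hd.hd
    have h2 : Comp (fun p => p.base.n) q env₁ (fun p => Val.ofList
      (((BoolList.table p.base.M p.base.rows).drop
          (p.i * ∑ j : Fin q, p.base.M ^ (j : ℕ))).map Val.ofBool)) := Comp.id.tl.hd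
    have h3 : Comp (fun p => p.base.n) q env₁ (fun p => Val.ofBool (decide (∃ k < p.i,
          (BoolList.table p.base.M p.base.rows).getD (k * ∑ j : Fin q, p.base.M ^ (j : ℕ)) false
            = true))) := Comp.id.tl.tl
    have h4 := h2.hd.congr (fun _ => rfl) fun p => Val.hd_ofBools_drop _ _
    refine ((Comp.drop (fun p : NCtx (M (q := q)) => hR p.base) h2 h1).cons (h3.or h4)).congr (fun _ => rfl) fun p => ?_
    refine congrArg₂ _ ?_ (congrArg Val.ofBool ?_)
    · rw [← List.map_drop, List.drop_drop, add_mul, one_mul]; rfl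
    · rw [Bool.eq_iff_iff, Bool.or_eq_true, decide_eq_true_iff, decide_eq_true_iff]
      simp only [Nat.lt_succ_iff_lt_or_eq, or_and_right, exists_or, exists_eq_left]

open Classical in
theorem comp_solvable (q : ℕ) :
    Comp n (q + 1) env (fun γ : MCtx q => Val.ofBool (decide γ.Solvable)) := by
  -- Without columns, solvability means that there are no rows, that is, that the encoded matrix is
  -- `nil`.
  rcases Nat.eq_zero_or_pos q with rfl | hq
  · refine ((Comp.id (env := env)).ite (q := fun γ => γ.env ≠ Val.nil) (fun _ => Iff.rfl) Comp.nil
      (Comp.const (Val.ofBool true))).congr (fun _ => rfl) fun γ => ?_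
    obtain ⟨n, p, r, h1, h2⟩ := γ
    cases p with
    | zero =>
      rw [if_neg (by simp [env, Val.ofMatrix]), decide_eq_true]
      exact ⟨Fin.elim0, 0, fun i => i.elim0, fun j => j.elim0⟩
    | succ p =>
      rw [if_pos (by simp [env, Val.ofMatrix, List.ofFn_succ]), decide_eq_false]
      · rfl
      · rintro ⟨φ, -⟩
        exact (φ 0).elim0
  · exact (comp_solvable_of_pos hq).mono (by omega)

end MCtx

/-! ### Deciding from the covering pattern -/

namespace DartGraph

theorem sum_card_supp {V D : Type*} [Finite V] (G : DartGraph V D) {p : ℕ}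
    (g : Fin p ≃ G.Component) : ∑ i, Nat.card (g i).supp = Nat.card V := by
  rw [← Nat.card_congr (Equiv.sigmaFiberEquiv fun v => g.symm (G.adjGraph.connectedComponentMk v)),
    Nat.card_sigma]
  exact Finset.sum_congr rfl fun i _ => Nat.card_congr
    (Equiv.subtypeEquivRight fun v => (Equiv.symm_apply_eq g).symm)

end DartGraph

/-- An input graph with a numbering of its components. -/
structure PatCtx extends GCtx where
  p : ℕ
  g : Fin p ≃ G.Component

namespace PatCtx

variable {V D : Type*} (H : DartGraph V D) {q : ℕ} (h : Fin q ≃ H.Component)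

/-- The covering pattern as a matrix. -/
noncomputable def toMCtx (γ : PatCtx) : MCtx q where
  n := γ.size
  p := γ.p
  r i j := γ.G.covPattern H (γ.g i) (h j)
  p_le := by
    refine le_trans ?_ ((γ.G.sum_card_supp γ.g).trans_le (Nat.le_add_right _ _))
    calc γ.p = ∑ _i : Fin γ.p, 1 := by simp
      _ ≤ _ := Finset.sum_le_sum fun i _ => DartGraph.card_supp_pos (γ.g i)
  sum_le j := (Finset.sum_le_sum fun i _ => DartGraph.covPattern_le (γ.g i) (h j)).trans
    ((γ.G.sum_card_supp γ.g).trans_le (Nat.le_add_right _ _))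

/-- Components are nonempty and weights are at most their vertex counts, so the size of `G` bounds
both the number of rows and all column sums. -/
theorem exists_decide [Finite V] : ∃ (P : Prog) (C : ℕ), ∀ γ : PatCtx,
    P.AnswersWithin (Val.ofCovPattern γ.G H γ.g h) (γ.G.EquitablyCovers H)
      (C * (γ.G.size + 1) ^ (q + 1)) := by
  classical
  refine ((MCtx.comp_solvable q).reindex (toMCtx H h)).exists_answersWithin fun γ => ?_
  rw [Val.ofBool_ne_nil, decide_eq_true_iff, DartGraph.equitablyCovers_iff γ.g h]
  rfl

end PatCtx

/-! ### The two programs combined. -/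

theorem Polynomial.eval_C_mul_X_add_one_pow (C k n : ℕ) :
    (Polynomial.C C * (Polynomial.X + 1) ^ k).eval n = C * (n + 1) ^ k := by
  simp

/-- The second program is correct for every numbering of the components, in particular for the
numbering by roots that the first one produces. -/
theorem exists_build_decide {V D : Type*} [Finite V] (H : DartGraph V D)
    (hH : ∀ c : H.Component, PolyTimeSolvable (CoverProblem (H.component c))) {q : ℕ}
    (h : Fin q ≃ H.Component) : ∃ build decide : Prog,
      (Prog.seq build decide).SolvesInPolyTime (EquitableCoverProblem H) ∧
      (∃ T : Polynomial ℕ, ∀ (a b : ℕ) (G : DartGraph (Fin a) (Fin b)),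
        ∃ (p : ℕ) (g : Fin p ≃ G.Component),
          build.OutputsWithin (Val.ofGraph G) (Val.ofCovPattern G H g h) (T.eval G.size)) ∧
      (∃ C : ℕ, ∀ (a b : ℕ) (G : DartGraph (Fin a) (Fin b)) (p : ℕ) (g : Fin p ≃ G.Component),
        decide.AnswersWithin (Val.ofCovPattern G H g h) (G.EquitablyCovers H)
          (C * (G.size + 1) ^ (q + 1))) := by
  obtain ⟨k, hk⟩ := GCtx.pcomp_covPattern H hH h
  obtain ⟨build, C, hb⟩ := hk.exists_outputsWithin
  obtain ⟨decide, C', hd⟩ := PatCtx.exists_decide H h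
  refine ⟨build, decide, ?_, ?_, C', fun a b G p g => hd ⟨⟨a, b, G⟩, p, g⟩⟩
  · refine ⟨Polynomial.C C * (Polynomial.X + 1) ^ k +
      Polynomial.C C' * (Polynomial.X + 1) ^ (q + 1), fun a b G => ?_⟩
    obtain ⟨t, e, ht⟩ := hb ⟨a, b, G⟩
    obtain ⟨t', s, e', ht', hs⟩ := hd ⟨⟨a, b, G⟩, _, G.rootEquiv⟩
    refine ⟨t + t', s, .seq e e', ?_, hs⟩
    rw [Polynomial.eval_add, Polynomial.eval_C_mul_X_add_one_pow,
      Polynomial.eval_C_mul_X_add_one_pow]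
    exact Nat.add_le_add ht ht'
  · refine ⟨Polynomial.C C * (Polynomial.X + 1) ^ k, fun a b G => ⟨_, G.rootEquiv, ?_⟩⟩
    rw [Polynomial.eval_C_mul_X_add_one_pow]
    exact hb ⟨a, b, G⟩

theorem mainTheorem3 {V D : Type*} [Finite V] [Finite D] (H : DartGraph V D)
    (hH : ∀ c : H.Component, PolyTimeSolvable (CoverProblem (H.component c))) :
    PolyTimeSolvable (EquitableCoverProblem H) ∧
    ∀ (q : ℕ) (h : Fin q ≃ H.Component), ∃ build decide : Prog,
      (Prog.seq build decide).SolvesInPolyTime (EquitableCoverProblem H) ∧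
      (∃ T : Polynomial ℕ, ∀ (a b : ℕ) (G : DartGraph (Fin a) (Fin b)),
        ∃ (p : ℕ) (g : Fin p ≃ G.Component),
          build.OutputsWithin (Val.ofGraph G) (Val.ofCovPattern G H g h) (T.eval G.size)) ∧
      (∃ C : ℕ, ∀ (a b : ℕ) (G : DartGraph (Fin a) (Fin b)) (p : ℕ) (g : Fin p ≃ G.Component),
        decide.AnswersWithin (Val.ofCovPattern G H g h) (G.EquitablyCovers H)
          (C * (G.size + 1) ^ (q + 1))) := by
  exact ⟨(exists_build_decide H hH (Finite.equivFin H.Component).symm).elim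
    fun build ⟨decide, hs, _⟩ => ⟨_, hs⟩, fun q h => exists_build_decide H hH h⟩
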